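/- Let $X$ be one of the following diffusions, with $\nu_0>0$, $\mu:=2\lambda_0/\nu_0^2-1$, $\kappa:=2\lambda_1/\nu_0^2$: the squared Bessel (SQB) diffusion $dX=\lambda_0\,dt+\nu_0\sqrt{X}\,dW$ on $\mathcal I=(0,\infty)$ with $\mu>0$; the CIR diffusion $dX=(\lambda_0-\lambda_1X)\,dt+\nu_0\sqrt X\,dW$ on $\mathcal I=(0,\infty)$ with $\mu>0$, $\lambda_1>0$; or the Ornstein–Uhlenbeck (OU) diffusion $dX=(\lambda_0-\lambda_1X)\,dt+\nu_0\,dW$ on $\mathcal I=\mathbb R$ with $\lambda_1>0$. For $\rho>0$ let $\varphi^+_\rho$ (increasing) and $\varphi^-_\rho$ (decreasing) be its fundamental solutions: \[ \begin{aligned} \text{SQB:}\quad&\varphi^+_\rho(x)=x^{-\mu/2}I_\mu\big(2\sqrt{2\rho x}/\nu_0\big),\quad \varphi^-_\rho(x)=x^{-\mu/2}K_\mu\big(2\sqrt{2\rho x}/\nu_0\big);\\ \text{CIR:}\quad&\varphi^+_\rho(x)=M(\rho/\lambda_1,\mu+1,\kappa x),\quad \varphi^-_\rho(x)=U(\rho/\lambda_1,\mu+1,\kappa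 x);\\ \text{OU:}\quad&\varphi^\pm_\rho(x)=e^{\kappa y^2/4}D_{-\rho/\lambda_1}(\mp\sqrt\kappa\,y),\quad y=x-\lambda_0/\lambda_1, \end{aligned} \] with $I_\mu,K_\mu$ the modified Bessel functions, $M,U$ the Kummer functions and $D$ the parabolic cylinder function. Let $a,b\in\mathbb R$, $b\neq0$, $\rho>0$, $\rho+b>0$, $\epsilon=\pm1$, and define on $\mathcal I$ \[ \begin{aligned} F^{(1)}_\pm&=-\frac ab+\epsilon c\,\frac{\varphi^\pm_{\rho+b}}{\varphi^\mp_\rho},& F^{(2)}_\pm&=-\frac ab+\epsilon c\,\frac{\varphi^\pm_{\rho+b}}{\varphi^\pm_\rho},\\ F^{(3)}_\pm&=-\frac ab+\epsilon\,\frac{c_1\varphi^+_{\rho+b}+c_2\varphi^-_{\rho+b}}{\varphi^\mp_\rho},& F^{(4)}_\pm&=-\frac ab+\epsilon\,\frac{\varphi^\pm_{\rho+b}}{q_1\varphi^+_\rho+q_2\varphi^-_\rho},\\ F^{(5)}&=-\frac ab+\epsilon\,\frac{c_1\varphi^+_{\rho+b}-c_2\varphi^-_{\rho+b}}{q_1\varphi^+_\rho+q_2\varphi^-_\rho},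 \end{aligned} \] where $c,c_1,c_2>0$ and $q_1,q_2>0$, except that in $F^{(5)}$ one of $q_1,q_2$ may be zero. Then: 1. $F^{(1)}_\pm$ and $F^{(2)}_\pm$ are strictly monotonic on $\mathcal I$ for all choices of the parameters; $dF^{(1)}_\pm/dx$ has the sign $\pm\epsilon$ and $dF^{(2)}_\pm/dx$ has the sign $\pm\epsilon\,\mathrm{sign}(b)$ on $\mathcal I$. 2. If $b<0$, then $F^{(3)}_\pm$ is strictly monotonic on $\mathcal I$ and $dF^{(3)}_\pm/dx$ has the sign $\pm\epsilon$. 3. If $b>0$, then $F^{(4)}_\pm$ is strictly monotonic on $\mathcal I$ and $dF^{(4)}_\pm/dx$ has the sign $\pm\epsilon$. 4. For all $a,b,\rho,\epsilon,q_1,q_2$ as above, $F^{(5)}$ is strictly monotonic on $\mathcal I$ for every choice of $c_1,c_2>0$ if and only if $b>0$; and if $b>0$, then $dF^{(5)}/dx$ has the sign $\epsilon$. If moreover $q_1>0$, or $X$ is OU, or $\mu\ge1$, then for each individual choice of $c_1,c_2>0$ the map $F^{(5)}$ is strictly monotonic if and only if $b>0$. -/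

import Mathlib

namespace AffineDiffusion

noncomputable section

/-! ### Special functions of a real variable -/

/-- Modified Bessel function of the first kind
`I_μ(z) = ∑ₖ (z/2)^(2k+μ) / (k! Γ(k+μ+1))`, for `z > 0`. -/
def besselI (μ z : ℝ) : ℝ :=
  ∑' k : ℕ, (z / 2) ^ (2 * (k : ℝ) + μ) / ((k.factorial : ℝ) * Real.Gamma ((k : ℝ) + μ + 1))

/-- Modified Bessel function of the second kind (Macdonald function)
`K_μ(z) = ∫₀^∞ exp(-z cosh t) cosh(μ t) dt`, for `z > 0`. -/
def besselK (μ z : ℝ) : ℝ :=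
  ∫ t in Set.Ioi (0 : ℝ), Real.exp (-z * Real.cosh t) * Real.cosh (μ * t)

/-- Kummer's confluent hypergeometric function
`M(α, β, z) = ∑ₙ (α)ₙ zⁿ / ((β)ₙ n!)`. -/
def kummerM (α β z : ℝ) : ℝ :=
  ∑' n : ℕ, (ascPochhammer ℝ n).eval α / (ascPochhammer ℝ n).eval β * z ^ n / (n.factorial : ℝ)

/-- Kummer's (Tricomi's) confluent hypergeometric function of the second kind
`U(α, β, z) = Γ(α)⁻¹ ∫₀^∞ exp(-z t) t^(α-1) (1+t)^(β-α-1) dt`, for `α > 0` and `z > 0`. -/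
def kummerU (α β z : ℝ) : ℝ :=
  (Real.Gamma α)⁻¹ *
    ∫ t in Set.Ioi (0 : ℝ), Real.exp (-z * t) * t ^ (α - 1) * (1 + t) ^ (β - α - 1)

/-- Whittaker's parabolic cylinder function of negative order `-υ`,
`D_{-υ}(z) = exp(-z²/4) Γ(υ)⁻¹ ∫₀^∞ t^(υ-1) exp(-z t - t²/2) dt`, for `υ > 0` and `z ∈ ℝ`. -/
def parabolicCylinderDNeg (υ z : ℝ) : ℝ :=
  Real.exp (-z ^ 2 / 4) * (Real.Gamma υ)⁻¹ *
    ∫ t in Set.Ioi (0 : ℝ), t ^ (υ - 1) * Real.exp (-z * t - t ^ 2 / 2)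

/-! ### The three underlying diffusions -/

/-- The three underlying diffusions with their parameters.
* `sqb`: squared Bessel process `dX = lam0 dt + nu0 √X dW` on `(0, ∞)`;
* `cir`: Cox-Ingersoll-Ross process `dX = (lam0 - lam1 X) dt + nu0 √X dW` on `(0, ∞)`;
* `ou`: Ornstein-Uhlenbeck process `dX = (lam0 - lam1 X) dt + nu0 dW` on `ℝ`.

For the first two the origin is an entrance boundary: `2 lam0 / nu0² - 1 > 0`. -/
inductive Diffusion : Type
  | sqb (lam0 nu0 : ℝ) (hnu : 0 < nu0) (hmu : 0 < 2 * lam0 / nu0 ^ 2 - 1) : Diffusion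
  | cir (lam0 lam1 nu0 : ℝ) (hlam1 : 0 < lam1) (hnu : 0 < nu0)
      (hmu : 0 < 2 * lam0 / nu0 ^ 2 - 1) : Diffusion
  | ou (lam0 lam1 nu0 : ℝ) (hlam1 : 0 < lam1) (hnu : 0 < nu0) : Diffusion

/-- The state space `(l, r)`. -/
def Diffusion.interval : Diffusion → Set ℝ
  | .sqb _ _ _ _ => Set.Ioi 0
  | .cir _ _ _ _ _ _ => Set.Ioi 0
  | .ou _ _ _ _ _ => Set.univ

/-- The sign in the superscript of `φ^±` and in the subscript of the maps `F_±`. -/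
inductive Pm : Type
  | plus : Pm
  | minus : Pm

/-- The opposite sign. -/
def Pm.flip : Pm → Pm
  | .plus => .minus
  | .minus => .plus

/-- The number `±1`. -/
def Pm.val : Pm → ℝ
  | .plus => 1
  | .minus => -1

/-- The fundamental solutions `φ^±_ρ(x)` of `𝒢 φ = ρ φ`, where `𝒢` is the generator.
With `μ = 2 lam0 / nu0² - 1`, `κ = 2 lam1 / nu0²`, `υ = ρ / lam1`:
* SQB: `x^(-μ/2) I_μ(2 √(2ρx) / nu0)` and `x^(-μ/2) K_μ(2 √(2ρx) / nu0)`;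
* CIR: `M(υ, μ+1, κx)` and `U(υ, μ+1, κx)`;
* OU: `exp(κy²/4) D_{-υ}(∓√κ y)` with `y = x - lam0 / lam1`. -/
def Diffusion.phi : Diffusion → Pm → ℝ → ℝ → ℝ
  | .sqb lam0 nu0 _ _, .plus, ρ, x =>
      x ^ (-(2 * lam0 / nu0 ^ 2 - 1) / 2) *
        besselI (2 * lam0 / nu0 ^ 2 - 1) (2 * Real.sqrt (2 * ρ * x) / nu0)
  | .sqb lam0 nu0 _ _, .minus, ρ, x =>
      x ^ (-(2 * lam0 / nu0 ^ 2 - 1) / 2) *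
        besselK (2 * lam0 / nu0 ^ 2 - 1) (2 * Real.sqrt (2 * ρ * x) / nu0)
  | .cir lam0 lam1 nu0 _ _ _, .plus, ρ, x =>
      kummerM (ρ / lam1) ((2 * lam0 / nu0 ^ 2 - 1) + 1) (2 * lam1 / nu0 ^ 2 * x)
  | .cir lam0 lam1 nu0 _ _ _, .minus, ρ, x =>
      kummerU (ρ / lam1) ((2 * lam0 / nu0 ^ 2 - 1) + 1) (2 * lam1 / nu0 ^ 2 * x)
  | .ou lam0 lam1 nu0 _ _, .plus, ρ, x =>
      Real.exp (2 * lam1 / nu0 ^ 2 * (x - lam0 / lam1) ^ 2 / 4) *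
        parabolicCylinderDNeg (ρ / lam1)
          (-(Real.sqrt (2 * lam1 / nu0 ^ 2) * (x - lam0 / lam1)))
  | .ou lam0 lam1 nu0 _ _, .minus, ρ, x =>
      Real.exp (2 * lam1 / nu0 ^ 2 * (x - lam0 / lam1) ^ 2 / 4) *
        parabolicCylinderDNeg (ρ / lam1)
          (Real.sqrt (2 * lam1 / nu0 ^ 2) * (x - lam0 / lam1))

/-- The diffusion is the OU diffusion, or an SQB or CIR diffusion with `μ ≥ 1`. -/
def Diffusion.IsOUOrOneLeMu : Diffusion → Prop
  | .sqb lam0 nu0 _ _ => 1 ≤ 2 * lam0 / nu0 ^ 2 - 1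
  | .cir lam0 _ nu0 _ _ _ => 1 ≤ 2 * lam0 / nu0 ^ 2 - 1
  | .ou _ _ _ _ _ => True

/-! ### The five classes of maps -/

/-- `F^(1)_±(x) = -a/b + ε c φ^±_{ρ+b}(x) / φ^∓_ρ(x)`. -/
def F1 (X : Diffusion) (s : Pm) (a b ρ ε c : ℝ) (x : ℝ) : ℝ :=
  -(a / b) + ε * (c * (X.phi s (ρ + b) x / X.phi s.flip ρ x))

/-- `F^(2)_±(x) = -a/b + ε c φ^±_{ρ+b}(x) / φ^±_ρ(x)`. -/
def F2 (X : Diffusion) (s : Pm) (a b ρ ε c : ℝ) (x : ℝ) : ℝ :=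
  -(a / b) + ε * (c * (X.phi s (ρ + b) x / X.phi s ρ x))

/-- `F^(3)_±(x) = -a/b + ε (c₁ φ^+_{ρ+b}(x) + c₂ φ^-_{ρ+b}(x)) / φ^∓_ρ(x)`. -/
def F3 (X : Diffusion) (s : Pm) (a b ρ ε c₁ c₂ : ℝ) (x : ℝ) : ℝ :=
  -(a / b) + ε * ((c₁ * X.phi .plus (ρ + b) x + c₂ * X.phi .minus (ρ + b) x) /
    X.phi s.flip ρ x)

/-- `F^(4)_±(x) = -a/b + ε φ^±_{ρ+b}(x) / (q₁ φ^+_ρ(x) + q₂ φ^-_ρ(x))`. -/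
def F4 (X : Diffusion) (s : Pm) (a b ρ ε q₁ q₂ : ℝ) (x : ℝ) : ℝ :=
  -(a / b) + ε * (X.phi s (ρ + b) x / (q₁ * X.phi .plus ρ x + q₂ * X.phi .minus ρ x))

/-- `F^(5)(x) = -a/b + ε (c₁ φ^+_{ρ+b}(x) - c₂ φ^-_{ρ+b}(x)) / (q₁ φ^+_ρ(x) + q₂ φ^-_ρ(x))`. -/
def F5 (X : Diffusion) (a b ρ ε c₁ c₂ q₁ q₂ : ℝ) (x : ℝ) : ℝ :=
  -(a / b) + ε * ((c₁ * X.phi .plus (ρ + b) x - c₂ * X.phi .minus (ρ + b) x) /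
    (q₁ * X.phi .plus ρ x + q₂ * X.phi .minus ρ x))

/-- `F` is strictly monotonic (increasing or decreasing) on the state space. -/
def StrictlyMonotonic (X : Diffusion) (F : ℝ → ℝ) : Prop :=
  StrictMonoOn F X.interval ∨ StrictAntiOn F X.interval

/-- `F` is differentiable on the state space and its derivative has the sign `δ` everywhere. -/
def DerivHasSign (X : Diffusion) (F : ℝ → ℝ) (δ : ℝ) : Prop :=
  ∀ x ∈ X.interval, DifferentiableAt ℝ F x ∧ Real.sign (deriv F x) = δ

end

end AffineDiffusion

namespace AffineDiffusion

open MeasureTheory ProbabilityTheory Filter Topology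

/-! The derivative of a quotient N/D has the sign of N'D − ND', so parts 1 to 3 and the positive
half of part 4 reduce to the signs of Wronskians of two fundamental solutions. For φ⁺ against φ⁻ the
sign is immediate, since one is positive and increasing, the other positive and decreasing. For two
solutions of the same type with parameters ρ₁ < ρ₂, the logarithmic derivative of φ⁺ must increase
with ρ and that of φ⁻ must decrease.

This comes from one mechanism. Each solution is a positive constant times ∫ exp(sY) w_ρ dm at s =
u(x), with w_ρ > 0 and Y ≥ 0: a power series with s = log x for φ⁺ of SQB and CIR, a Laplace
transform for φ⁻ and for both OU solutions. The logarithmic derivative in s is the mean of Y under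
the tilted weight. In all cases w_{ρ₂}/w_{ρ₁} is an increasing function of Y, so this mean is larger
for ρ₂ (Chebyshev's correlation inequality, `deriv_expInt_mul_lt`); the sign of u' then gives the
direction.

For b < 0 the map F⁽⁵⁾ must fail to be monotonic. Its numerator is negative near the left endpoint
and positive near +∞, so it cannot decrease. If q₁ > 0, it tends to −a/b at +∞ because φ⁺_ρ outgrows
φ⁺_{ρ+b}; being on the ε-side of −a/b somewhere, it cannot increase either (up to ε). If q₁ = 0, the
left endpoint decides: φ⁻_{ρ+b}/φ⁻_ρ has a limit r there, and if φ⁻_{ρ+b} − rφ⁻_ρ → ∞ then the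
quotient drops below its left limit. This holds for OU with r = 0, and for SQB and CIR when μ ≥ 1,
by an Abelian estimate of the Laplace transforms at the origin (`expFamily_ratio`). Without that
condition, a large c₂ still forces a decrease between two points, which suffices for the statement
about all c₁, c₂. -/

/-- The exponential integral `s ↦ ∫ exp(s X) w dm`. -/
noncomputable def expInt {Ω : Type*} [MeasurableSpace Ω] (m : Measure Ω) (X w : Ω → ℝ) (s : ℝ) : ℝ :=
  ∫ ω, Real.exp (s * X ω) * w ω ∂m

/-- `w` is a positive weight whose exponential integrals converge for parameters in `U`. -/
structure IsExpWeight {Ω : Type*} [MeasurableSpace Ω] (m : Measure Ω) (X : Ω → ℝ) (U : Set ℝ)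
    (w : Ω → ℝ) : Prop where
  measurable : Measurable w
  pos : ∀ᵐ ω ∂m, 0 < w ω
  integrable : ∀ s ∈ U, Integrable (fun ω => Real.exp (s * X ω) * w ω) m

/-- `X` is measurable, almost everywhere positive or zero, and essentially unbounded. -/
structure IsUnboundedNonneg {Ω : Type*} [MeasurableSpace Ω] (m : Measure Ω) (X : Ω → ℝ) : Prop where
  measurable : Measurable X
  nonneg : ∀ᵐ ω ∂m, 0 ≤ X ω
  unbounded : ∀ K : ℝ, m {ω | K < X ω} ≠ 0

/-! ### Exponential integrals: derivatives, comparison and growth -/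

section ExpInt

variable {Ω : Type*} [MeasurableSpace Ω] {m : Measure Ω} {X : Ω → ℝ} {U : Set ℝ} {w w₁ w₂ : Ω → ℝ}

/-- Absorbing w into the measure as a density turns the exponential integral into a moment
generating function, which may be differentiated in the interior of its domain of convergence.
Openness of U places s in that interior. -/
theorem IsExpWeight.integrable_and_hasDerivAt (hw : IsExpWeight m X U w) (hU : IsOpen U) {s : ℝ}
    (hs : s ∈ U) :
    Integrable (fun ω => X ω * (Real.exp (s * X ω) * w ω)) m ∧
      HasDerivAt (expInt m X w) (∫ ω, X ω * (Real.exp (s * X ω) * w ω) ∂m) s := by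
  set d : Ω → ENNReal := fun ω => ENNReal.ofReal (w ω) with hd
  have hdm : Measurable d := hw.measurable.ennreal_ofReal
  have hdf : ∀ᵐ ω ∂m, d ω < ⊤ := by simp [hd]
  have hdw : ∀ᵐ ω ∂m, (d ω).toReal = w ω := by
    filter_upwards [hw.pos] with ω h
    simp [hd, h.le]
  have hint : ∀ g : Ω → ℝ, ∫ ω, g ω ∂(m.withDensity d) = ∫ ω, g ω * w ω ∂m := by
    intro g
    rw [integral_withDensity_eq_integral_toReal_smul hdm hdf]
    refine integral_congr_ae ?_
    filter_upwards [hdw] with ω h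
    rw [h, smul_eq_mul, mul_comm]
  have hintg : ∀ g : Ω → ℝ, Integrable g (m.withDensity d) ↔ Integrable (fun ω => g ω * w ω) m := by
    intro g
    rw [integrable_withDensity_iff_integrable_smul' hdm hdf]
    refine integrable_congr ?_
    filter_upwards [hdw] with ω h
    rw [h, smul_eq_mul, mul_comm]
  have hsub : U ⊆ interior (integrableExpSet X (m.withDensity d)) := by
    refine interior_maximal ?_ hU
    intro u hu
    exact (hintg _).2 (hw.integrable u hu)
  have hmgf : mgf X (m.withDensity d) = expInt m X w := by
    funext u
    exact hint _
  have h1 := integrable_pow_mul_exp_of_mem_interior_integrableExpSet (hsub hs) 1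
  have h2 := hasDerivAt_mgf (hsub hs)
  rw [hmgf] at h2
  rw [hint] at h2
  rw [hintg] at h1
  refine ⟨?_, ?_⟩
  · simpa [mul_assoc] using h1
  · simpa [mul_assoc] using h2

theorem IsExpWeight.expInt_pos (hw : IsExpWeight m X U w) (hX : IsUnboundedNonneg m X) {s : ℝ}
    (hs : s ∈ U) : 0 < expInt m X w s := by
  unfold expInt
  rw [integral_pos_iff_support_of_nonneg_ae ?_ (hw.integrable s hs)]
  · refine pos_iff_ne_zero.2 fun h => hX.unbounded 0 ?_
    rw [← nonpos_iff_eq_zero, ← h]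
    refine measure_mono_ae ?_
    filter_upwards [hw.pos] with ω h _
    exact (mul_pos (Real.exp_pos _) h).ne'
  · filter_upwards [hw.pos] with ω h
    exact (mul_pos (Real.exp_pos _) h).le

theorem IsExpWeight.deriv_expInt_pos (hw : IsExpWeight m X U w) (hU : IsOpen U)
    (hX : IsUnboundedNonneg m X) {s : ℝ} (hs : s ∈ U) : 0 < deriv (expInt m X w) s := by
  obtain ⟨h1, h2⟩ := hw.integrable_and_hasDerivAt hU hs
  rw [h2.deriv, integral_pos_iff_support_of_nonneg_ae ?_ h1]
  · refine pos_iff_ne_zero.2 fun h => hX.unbounded 0 ?_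
    rw [← nonpos_iff_eq_zero, ← h]
    refine measure_mono_ae ?_
    filter_upwards [hw.pos] with ω h hω
    exact (mul_pos hω (mul_pos (Real.exp_pos _) h)).ne'
  · filter_upwards [hw.pos, hX.nonneg] with ω h h'
    exact mul_nonneg h' (mul_pos (Real.exp_pos _) h).le

theorem IsExpWeight.differentiableAt_expInt (hw : IsExpWeight m X U w) (hU : IsOpen U) {s : ℝ}
    (hs : s ∈ U) : DifferentiableAt ℝ (expInt m X w) s :=
  (hw.integrable_and_hasDerivAt hU hs).2.differentiableAt

/-- If `w₂ / w₁` increases with `X`, the logarithmic derivative of the exponential integral of `w₂`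
exceeds that of `w₁`. -/
theorem deriv_expInt_mul_lt (hw₁ : IsExpWeight m X U w₁) (hw₂ : IsExpWeight m X U w₂)
    (hU : IsOpen U) (hX : IsUnboundedNonneg m X)
    (hsep : ∀ a : ℝ, 0 < a → ∃ γ : ℝ, ∀ᵐ ω ∂m,
      (X ω ≤ a → w₂ ω ≤ γ * w₁ ω) ∧ (a < X ω → γ * w₁ ω < w₂ ω)) {s : ℝ} (hs : s ∈ U) :
    deriv (expInt m X w₁) s * expInt m X w₂ s < deriv (expInt m X w₂) s * expInt m X w₁ s := by
  obtain ⟨i1, d1⟩ := hw₁.integrable_and_hasDerivAt hU hs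
  obtain ⟨i2, d2⟩ := hw₂.integrable_and_hasDerivAt hU hs
  have p1 := hw₁.expInt_pos hX hs
  have p1' := hw₁.deriv_expInt_pos hU hX hs
  -- a is the mean of X under the tilted weight of w₁. Both factors X − a and w₂ − γ w₁ change sign
  -- at X = a, so their product f is nonnegative; on integration the γ-term vanishes by the choice
  -- of a.
  set a := deriv (expInt m X w₁) s / expInt m X w₁ s with ha
  obtain ⟨γ, hγ⟩ := hsep a (div_pos p1' p1)
  have j1 := hw₁.integrable s hs
  have j2 := hw₂.integrable s hs
  set f : Ω → ℝ := fun ω =>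
    (X ω - a) * (Real.exp (s * X ω) * (w₂ ω - γ * w₁ ω)) with hf
  have hfe : f = fun ω => (X ω * (Real.exp (s * X ω) * w₂ ω) - a * (Real.exp (s * X ω) * w₂ ω)) -
      γ * (X ω * (Real.exp (s * X ω) * w₁ ω) - a * (Real.exp (s * X ω) * w₁ ω)) := by
    funext ω; simp only [hf]; ring
  have k2 : Integrable (fun ω => X ω * (Real.exp (s * X ω) * w₂ ω) -
      a * (Real.exp (s * X ω) * w₂ ω)) m := i2.sub (j2.const_mul a)
  have k1 : Integrable (fun ω => X ω * (Real.exp (s * X ω) * w₁ ω) -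
      a * (Real.exp (s * X ω) * w₁ ω)) m := i1.sub (j1.const_mul a)
  have hfi : Integrable f m := by
    rw [hfe]; exact k2.sub (k1.const_mul γ)
  have hfpos : 0 < ∫ ω, f ω ∂m := by
    rw [integral_pos_iff_support_of_nonneg_ae ?_ hfi]
    · refine pos_iff_ne_zero.2 fun h => hX.unbounded a ?_
      rw [← nonpos_iff_eq_zero, ← h]
      refine measure_mono_ae ?_
      filter_upwards [hγ] with ω h (hω : a < X ω)
      exact (mul_pos (sub_pos.2 hω) (mul_pos (Real.exp_pos _) (sub_pos.2 (h.2 hω)))).ne'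
    · filter_upwards [hγ] with ω h
      rcases le_or_gt (X ω) a with hω | hω
      · exact mul_nonneg_of_nonpos_of_nonpos (sub_nonpos.2 hω)
          (mul_nonpos_of_nonneg_of_nonpos (Real.exp_pos _).le (sub_nonpos.2 (h.1 hω)))
      · exact (mul_pos (sub_pos.2 hω) (mul_pos (Real.exp_pos _) (sub_pos.2 (h.2 hω)))).le
  have e : ∫ ω, f ω ∂m = (deriv (expInt m X w₂) s - a * expInt m X w₂ s) -
      γ * (deriv (expInt m X w₁) s - a * expInt m X w₁ s) := by
    rw [hfe, integral_sub k2 (k1.const_mul γ), integral_sub i2 (j2.const_mul a),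
      integral_const_mul, integral_const_mul, integral_sub i1 (j1.const_mul a), integral_const_mul,
      d1.deriv, d2.deriv]
    rfl
  have e0 : deriv (expInt m X w₁) s - a * expInt m X w₁ s = 0 := by
    rw [ha, div_mul_cancel₀ _ p1.ne', sub_self]
  rw [e, e0, mul_zero, sub_zero, sub_pos, ha, div_mul_eq_mul_div, div_lt_iff₀ p1] at hfpos
  exact hfpos

/-- If `w₁ / w₂` tends to zero as `X → ∞`, and the exponential integral of `w₂` dominates every
`exp(s K)`, then the ratio of the exponential integrals tends to zero. -/
theorem tendsto_expInt_div_zero (hw₁ : IsExpWeight m X U w₁) (hw₂ : IsExpWeight m X U w₂)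
    (hX : IsUnboundedNonneg m X)
    (hdom : ∀ δ : ℝ, 0 < δ → ∃ K : ℝ, ∀ᵐ ω ∂m, K < X ω → w₁ ω ≤ δ * w₂ ω)
    {F : Filter ℝ} {s₀ : ℝ} (hs₀ : s₀ ∈ U) (hF : ∀ᶠ s in F, s ∈ U ∧ s₀ ≤ s)
    (hexp : ∀ K : ℝ, Tendsto (fun s => Real.exp (s * K) / expInt m X w₂ s) F (𝓝 0)) :
    Tendsto (fun s => expInt m X w₁ s / expInt m X w₂ s) F (𝓝 0) := by
  rw [Metric.tendsto_nhds]
  intro δ hδ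
  obtain ⟨K, hK⟩ := hdom (δ / 2) (half_pos hδ)
  have hlim : Tendsto (fun s => Real.exp (-(s₀ * K)) * expInt m X w₁ s₀ *
      (Real.exp (s * K) / expInt m X w₂ s)) F (𝓝 0) := by
    simpa using (hexp K).const_mul (Real.exp (-(s₀ * K)) * expInt m X w₁ s₀)
  have hlim' := hlim.eventually (gt_mem_nhds (half_pos hδ))
  filter_upwards [hF, hlim'] with s ⟨hs, hss⟩ hl
  have p1 := hw₁.expInt_pos hX hs
  have p2 := hw₂.expInt_pos hX hs
  rw [Real.dist_eq, sub_zero, abs_of_pos (div_pos p1 p2)]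
  -- Split at X = K. Beyond K the weights compare with factor δ/2. Up to K, exp(sX) ≤ exp((s − s₀)K)
  -- exp(s₀X) because s ≥ s₀, which leaves a multiple of exp(sK), negligible by `hexp`.
  have hle : expInt m X w₁ s ≤ δ / 2 * expInt m X w₂ s +
      Real.exp ((s - s₀) * K) * expInt m X w₁ s₀ := by
    have j := ((hw₂.integrable s hs).const_mul (δ / 2))
    have j' := ((hw₁.integrable s₀ hs₀).const_mul (Real.exp ((s - s₀) * K)))
    unfold expInt
    rw [← integral_const_mul, ← integral_const_mul, ← integral_add j j']
    refine integral_mono_ae (hw₁.integrable s hs) (j.add j') ?_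
    filter_upwards [hK, hw₁.pos, hw₂.pos] with ω h h1 h2
    rcases le_or_gt (X ω) K with hω | hω
    · have : Real.exp (s * X ω) ≤ Real.exp ((s - s₀) * K) * Real.exp (s₀ * X ω) := by
        rw [← Real.exp_add, Real.exp_le_exp]
        nlinarith
      have h3 := mul_le_mul_of_nonneg_right this h1.le
      have : 0 ≤ δ / 2 * (Real.exp (s * X ω) * w₂ ω) := by positivity
      linarith
    · have h3 := mul_le_mul_of_nonneg_left (h hω) (Real.exp_pos (s * X ω)).le
      have : 0 ≤ Real.exp ((s - s₀) * K) * (Real.exp (s₀ * X ω) * w₁ ω) := by positivity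
      linarith
  have e : Real.exp ((s - s₀) * K) = Real.exp (-(s₀ * K)) * Real.exp (s * K) := by
    rw [← Real.exp_add]; ring_nf
  rw [div_lt_iff₀ p2]
  have hl2 : Real.exp (-(s₀ * K)) * expInt m X w₁ s₀ *
      (Real.exp (s * K) / expInt m X w₂ s) * expInt m X w₂ s < δ / 2 * expInt m X w₂ s :=
    mul_lt_mul_of_pos_right hl p2
  have e2 : Real.exp (-(s₀ * K)) * expInt m X w₁ s₀ *
      (Real.exp (s * K) / expInt m X w₂ s) * expInt m X w₂ s =
      Real.exp ((s - s₀) * K) * expInt m X w₁ s₀ := by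
    rw [e]; field_simp
  linarith

/-- An exponential integral over all large parameters grows faster than every exponential. -/
theorem IsExpWeight.tendsto_exp_div_expInt (hw : IsExpWeight m X Set.univ w)
    (hX : IsUnboundedNonneg m X) (K : ℝ) :
    Tendsto (fun s => Real.exp (s * K) / expInt m X w s) atTop (𝓝 0) := by
  -- The mass beyond K + 1, rather than K, leaves a spare factor exp(−s) in the quotient.
  set A : Set Ω := {ω | K + 1 < X ω} with hA
  have hAm : MeasurableSet A := measurableSet_lt measurable_const hX.measurable
  have hwi : Integrable w m := by simpa using hw.integrable 0 trivial
  have hc : 0 < ∫ ω in A, w ω ∂m := by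
    rw [integral_pos_iff_support_of_nonneg_ae (ae_restrict_of_ae ?_) hwi.integrableOn]
    · refine pos_iff_ne_zero.2 fun h => hX.unbounded (K + 1) ?_
      rw [Measure.restrict_apply' hAm] at h
      rw [← nonpos_iff_eq_zero, ← h]
      refine measure_mono_ae ?_
      filter_upwards [hw.pos] with ω h hω
      exact ⟨h.ne', hω⟩
    · filter_upwards [hw.pos] with ω h
      exact h.le
  set c := ∫ ω in A, w ω ∂m
  have hlow : ∀ s : ℝ, 0 ≤ s → Real.exp (s * (K + 1)) * c ≤ expInt m X w s := by
    intro s hs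
    have hi := hw.integrable s trivial
    calc Real.exp (s * (K + 1)) * c = ∫ ω in A, Real.exp (s * (K + 1)) * w ω ∂m := by
          rw [integral_const_mul]
      _ ≤ ∫ ω in A, Real.exp (s * X ω) * w ω ∂m := by
          refine integral_mono_ae (hwi.integrableOn.const_mul _) hi.integrableOn ?_
          filter_upwards [ae_restrict_of_ae hw.pos, ae_restrict_mem hAm] with ω h hω
          have : s * (K + 1) ≤ s * X ω := mul_le_mul_of_nonneg_left (le_of_lt hω) hs
          exact mul_le_mul_of_nonneg_right (Real.exp_le_exp.2 this) h.le
      _ ≤ expInt m X w s := by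
          refine setIntegral_le_integral hi ?_
          filter_upwards [hw.pos] with ω h
          exact (mul_pos (Real.exp_pos _) h).le
  have hup : Tendsto (fun s : ℝ => Real.exp (-s) * c⁻¹) atTop (𝓝 0) := by
    simpa using Real.tendsto_exp_neg_atTop_nhds_zero.mul_const c⁻¹
  refine squeeze_zero' ?_ ?_ hup
  · exact Eventually.of_forall fun s =>
      (div_pos (Real.exp_pos _) (hw.expInt_pos hX trivial)).le
  · filter_upwards [eventually_ge_atTop 0] with s hs
    have h1 := hlow s hs
    calc Real.exp (s * K) / expInt m X w s ≤ Real.exp (s * K) / (Real.exp (s * (K + 1)) * c) := by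
          gcongr
      _ = Real.exp (-s) * c⁻¹ := by
          rw [mul_add, Real.exp_add, Real.exp_neg, mul_one]
          field_simp

theorem IsExpWeight.tendsto_expInt_atTop (hw : IsExpWeight m X Set.univ w)
    (hX : IsUnboundedNonneg m X) : Tendsto (expInt m X w) atTop atTop := by
  have h := hw.tendsto_exp_div_expInt hX 0
  simp only [mul_zero, Real.exp_zero, one_div] at h
  have h2 : Tendsto (fun s => (expInt m X w s)⁻¹) atTop (𝓝[>] 0) :=
    tendsto_nhdsWithin_iff.2 ⟨h, Eventually.of_forall fun s =>
      inv_pos.2 (hw.expInt_pos hX trivial)⟩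
  simpa [Function.comp_def] using tendsto_inv_nhdsGT_zero.comp h2

theorem tendsto_expInt_div_zero_atTop (hw₁ : IsExpWeight m X Set.univ w₁)
    (hw₂ : IsExpWeight m X Set.univ w₂) (hX : IsUnboundedNonneg m X)
    (hdom : ∀ δ : ℝ, 0 < δ → ∃ K : ℝ, ∀ᵐ ω ∂m, K < X ω → w₁ ω ≤ δ * w₂ ω) :
    Tendsto (fun s => expInt m X w₁ s / expInt m X w₂ s) atTop (𝓝 0) :=
  tendsto_expInt_div_zero hw₁ hw₂ hX hdom (s₀ := 0) trivial
    ((eventually_ge_atTop 0).mono fun _ h => ⟨trivial, h⟩) fun K => hw₂.tendsto_exp_div_expInt hX K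

theorem IsExpWeight.tendsto_expInt_atBot (hw : IsExpWeight m X U w) (hXm : Measurable X)
    (hX : ∀ᵐ ω ∂m, 0 < X ω) {s₀ : ℝ} (hs₀ : s₀ ∈ U) :
    Tendsto (expInt m X w) atBot (𝓝 0) := by
  have : Tendsto (expInt m X w) atBot (𝓝 (∫ _, (0 : ℝ) ∂m)) := by
    unfold expInt
    refine tendsto_integral_filter_of_dominated_convergence
      (fun ω => Real.exp (s₀ * X ω) * w ω) ?_ ?_ (hw.integrable s₀ hs₀) ?_
    · exact Eventually.of_forall fun s =>
        (((hXm.const_mul s).exp).mul hw.measurable).aestronglyMeasurable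
    · filter_upwards [eventually_le_atBot s₀] with s hs
      filter_upwards [hX, hw.pos] with ω h h'
      rw [Real.norm_of_nonneg (by positivity)]
      gcongr
    · filter_upwards [hX] with ω h
      have : Tendsto (fun s : ℝ => s * X ω) atBot atBot := tendsto_id.atBot_mul_const h
      simpa using (Real.tendsto_exp_atBot.comp this).mul_const (w ω)
  simpa using this

end ExpInt

/-- If `w(t) ≥ c / t` for `t ≥ 1`, then the Laplace transform of `w` blows up at the origin. -/
theorem IsExpWeight.tendsto_expInt_nhdsLT_zero {w : ℝ → ℝ} {c : ℝ}
    (hw : IsExpWeight (volume.restrict (Set.Ioi 0)) id (Set.Iio 0) w) (hc : 0 < c)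
    (hle : ∀ t : ℝ, 1 ≤ t → c / t ≤ w t) :
    Tendsto (expInt (volume.restrict (Set.Ioi 0)) id w) (𝓝[<] 0) atTop := by
  -- For 1 < t ≤ 1/|s| the exponential is at least 1/e, and the integral of c/t over this range is c
  -- log(1/|s|).
  have hlow : ∀ s : ℝ, s < 0 → -1 < s →
      Real.exp (-1) * c * Real.log (-s)⁻¹ ≤ expInt (volume.restrict (Set.Ioi 0)) id w s := by
    intro s hs hs1
    have hs' : 0 < -s := neg_pos.2 hs
    have hT : 1 ≤ (-s)⁻¹ := (one_le_inv₀ hs').2 (by linarith)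
    have hi := hw.integrable s hs
    have hsub : Set.Ioc 1 (-s)⁻¹ ⊆ Set.Ioi (0 : ℝ) := fun t ht => lt_trans one_pos ht.1
    have hci : IntegrableOn (fun t : ℝ => Real.exp (-1) * c * t⁻¹) (Set.Ioc 1 (-s)⁻¹) := by
      rw [← intervalIntegrable_iff_integrableOn_Ioc_of_le hT]
      refine (intervalIntegral.intervalIntegrable_inv ?_ continuousOn_id).const_mul _
      intro x hx
      rw [Set.uIcc_of_le hT] at hx
      exact (lt_of_lt_of_le one_pos hx.1).ne'
    calc Real.exp (-1) * c * Real.log (-s)⁻¹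
        = ∫ t in Set.Ioc 1 (-s)⁻¹, Real.exp (-1) * c * t⁻¹ := by
          rw [← intervalIntegral.integral_of_le hT, intervalIntegral.integral_const_mul,
            integral_inv_of_pos one_pos (by positivity), div_one]
      _ ≤ ∫ t in Set.Ioc 1 (-s)⁻¹, Real.exp (s * id t) * w t := by
          refine setIntegral_mono_on hci (IntegrableOn.mono_set hi hsub) measurableSet_Ioc ?_
          intro t ht
          have h1 : -1 ≤ s * t := by
            have := mul_le_mul_of_nonneg_left ht.2 hs'.le
            rw [mul_inv_cancel₀ hs'.ne'] at this
            linarith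
          have h2 : Real.exp (-1) ≤ Real.exp (s * t) := Real.exp_le_exp.2 h1
          have h3 := hle t ht.1.le
          have h4 : 0 ≤ c / t := div_nonneg hc.le (lt_trans one_pos ht.1).le
          calc Real.exp (-1) * c * t⁻¹ = Real.exp (-1) * (c / t) := by ring
            _ ≤ Real.exp (s * t) * w t := by gcongr
      _ ≤ expInt (volume.restrict (Set.Ioi 0)) id w s := by
          refine setIntegral_mono_set hi ?_ hsub.eventuallyLE
          filter_upwards [hw.pos] with ω h
          exact (mul_pos (Real.exp_pos _) h).le
  have hn : Tendsto (fun s : ℝ => (-s)⁻¹) (𝓝[<] 0) atTop := by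
    refine tendsto_inv_nhdsGT_zero.comp ?_
    simpa using tendsto_neg_nhdsLT (a := (0 : ℝ))
  have hlim : Tendsto (fun s : ℝ => Real.exp (-1) * c * Real.log (-s)⁻¹) (𝓝[<] 0) atTop :=
    (Real.tendsto_log_atTop.comp hn).const_mul_atTop (by positivity)
  refine tendsto_atTop_mono' _ ?_ hlim
  filter_upwards [self_mem_nhdsWithin, nhdsWithin_le_nhds (Ioi_mem_nhds (by norm_num : (-1 : ℝ) < 0))]
    with s h1 h2
  exact hlow s h1 h2

/-! ### State spaces and signs of derivatives -/

theorem Diffusion.isOpen_interval (X : Diffusion) : IsOpen X.interval := by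
  cases X
  exacts [isOpen_Ioi, isOpen_Ioi, isOpen_univ]

theorem Diffusion.convex_interval (X : Diffusion) : Convex ℝ X.interval := by
  cases X
  exacts [convex_Ioi 0, convex_Ioi 0, convex_univ]

theorem Diffusion.mem_interval_of_pos (X : Diffusion) {x : ℝ} (hx : 0 < x) : x ∈ X.interval := by
  cases X
  exacts [hx, hx, trivial]

theorem DerivHasSign.strictlyMonotonic {X : Diffusion} {F : ℝ → ℝ} {δ : ℝ}
    (h : DerivHasSign X F δ) (hδ : δ = 1 ∨ δ = -1) : StrictlyMonotonic X F := by
  have hc : ContinuousOn F X.interval := fun x hx =>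
    (h x hx).1.continuousAt.continuousWithinAt
  rcases hδ with rfl | rfl
  · refine Or.inl (strictMonoOn_of_deriv_pos X.convex_interval hc fun x hx => ?_)
    rw [X.isOpen_interval.interior_eq] at hx
    by_contra hn
    have hs := (h x hx).2
    rcases (not_lt.1 hn).eq_or_lt with h0 | h0
    · rw [h0, Real.sign_zero] at hs; norm_num at hs
    · rw [Real.sign_of_neg h0] at hs; norm_num at hs
  · refine Or.inr (strictAntiOn_of_deriv_neg X.convex_interval hc fun x hx => ?_)
    rw [X.isOpen_interval.interior_eq] at hx
    by_contra hn
    have hs := (h x hx).2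
    rcases (not_lt.1 hn).eq_or_lt with h0 | h0
    · rw [← h0, Real.sign_zero] at hs; norm_num at hs
    · rw [Real.sign_of_pos h0] at hs; norm_num at hs

theorem real_sign_mul_of_pos {y σ : ℝ} (hσ : σ = 1 ∨ σ = -1) (h : 0 < σ * y) : Real.sign y = σ := by
  rcases hσ with rfl | rfl
  · exact Real.sign_of_pos (by linarith)
  · exact Real.sign_of_neg (by linarith)

/-- The sign of the derivative of `k + ε N / D` is `ε` times the sign of `N' D - N D'`. -/
theorem derivHasSign_quotient {X : Diffusion} {N D : ℝ → ℝ} {k ε σ : ℝ}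
    (hN : ∀ x ∈ X.interval, DifferentiableAt ℝ N x)
    (hD : ∀ x ∈ X.interval, DifferentiableAt ℝ D x)
    (hDpos : ∀ x ∈ X.interval, 0 < D x) (hσ : σ = 1 ∨ σ = -1) (hε : ε = 1 ∨ ε = -1)
    (h : ∀ x ∈ X.interval, 0 < σ * (deriv N x * D x - N x * deriv D x)) :
    DerivHasSign X (fun x => k + ε * (N x / D x)) (σ * ε) := by
  intro x hx
  have hd : HasDerivAt (fun x => k + ε * (N x / D x))
      (ε * ((deriv N x * D x - N x * deriv D x) / D x ^ 2)) x :=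
    (((hN x hx).hasDerivAt.div (hD x hx).hasDerivAt (hDpos x hx).ne').const_mul ε).const_add k
  refine ⟨hd.differentiableAt, ?_⟩
  rw [hd.deriv]
  have hpos : 0 < σ * (deriv N x * D x - N x * deriv D x) / D x ^ 2 :=
    div_pos (h x hx) (pow_pos (hDpos x hx) 2)
  refine real_sign_mul_of_pos ?_ ?_
  · rcases hσ with rfl | rfl <;> rcases hε with rfl | rfl <;> norm_num
  · have hεε : ε * ε = 1 := by rcases hε with rfl | rfl <;> norm_num
    calc 0 < σ * (deriv N x * D x - N x * deriv D x) / D x ^ 2 := hpos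
      _ = σ * (ε * ε) * ((deriv N x * D x - N x * deriv D x) / D x ^ 2) := by rw [hεε]; ring
      _ = _ := by ring

theorem strictlyMonotonic_affine_iff {X : Diffusion} {G : ℝ → ℝ} {k ε : ℝ} (hε : ε = 1 ∨ ε = -1) :
    StrictlyMonotonic X (fun x => k + ε * G x) ↔ StrictlyMonotonic X G := by
  unfold StrictlyMonotonic StrictMonoOn StrictAntiOn
  rcases hε with rfl | rfl
  · simp
  · simp only [add_lt_add_iff_left, neg_mul, one_mul, neg_lt_neg_iff]
    exact or_comm

/-- The analytic properties of the fundamental solutions of `X` that determine the monotonicity of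
the maps; `l` is the filter of neighbourhoods of the left endpoint. -/
structure Diffusion.HasRegularSolutions (X : Diffusion) (l : Filter ℝ) : Prop where
  neBot : l.NeBot
  left : ∀ x ∈ X.interval, ∀ᶠ y in l, y ∈ X.interval ∧ y < x
  pos : ∀ s ρ, 0 < ρ → ∀ x ∈ X.interval, 0 < X.phi s ρ x
  differentiableAt : ∀ s ρ, 0 < ρ → ∀ x ∈ X.interval, DifferentiableAt ℝ (X.phi s ρ) x
  deriv_plus_pos : ∀ ρ, 0 < ρ → ∀ x ∈ X.interval, 0 < deriv (X.phi .plus ρ) x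
  deriv_minus_neg : ∀ ρ, 0 < ρ → ∀ x ∈ X.interval, deriv (X.phi .minus ρ) x < 0
  wronskian_plus : ∀ ρ₁ ρ₂, 0 < ρ₁ → ρ₁ < ρ₂ → ∀ x ∈ X.interval,
    deriv (X.phi .plus ρ₁) x * X.phi .plus ρ₂ x < deriv (X.phi .plus ρ₂) x * X.phi .plus ρ₁ x
  wronskian_minus : ∀ ρ₁ ρ₂, 0 < ρ₁ → ρ₁ < ρ₂ → ∀ x ∈ X.interval,
    deriv (X.phi .minus ρ₂) x * X.phi .minus ρ₁ x < deriv (X.phi .minus ρ₁) x * X.phi .minus ρ₂ x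
  minus_left : ∀ ρ, 0 < ρ → Tendsto (X.phi .minus ρ) l atTop
  minus_right : ∀ ρ, 0 < ρ → Tendsto (X.phi .minus ρ) atTop (𝓝 0)
  plus_ratio_right : ∀ ρ₁ ρ₂, 0 < ρ₁ → ρ₁ < ρ₂ →
    Tendsto (fun x => X.phi .plus ρ₁ x / X.phi .plus ρ₂ x) atTop (𝓝 0)
  minus_ratio_left : X.IsOUOrOneLeMu → ∀ ρ₁ ρ₂, 0 < ρ₁ → ρ₁ < ρ₂ → ∃ r : ℝ,
    Tendsto (fun x => X.phi .minus ρ₁ x / X.phi .minus ρ₂ x) l (𝓝 r) ∧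
    Tendsto (fun x => X.phi .minus ρ₁ x - r * X.phi .minus ρ₂ x) l atTop

/-! ### Signs of the derivatives of the five classes -/

namespace Diffusion.HasRegularSolutions

variable {X : Diffusion} {l : Filter ℝ} {a b ρ ε : ℝ}

theorem deriv_combination (h : X.HasRegularSolutions l) (hρ : 0 < ρ) (q₁ q₂ : ℝ) {x : ℝ}
    (hx : x ∈ X.interval) :
    HasDerivAt (fun x => q₁ * X.phi .plus ρ x + q₂ * X.phi .minus ρ x)
      (q₁ * deriv (X.phi .plus ρ) x + q₂ * deriv (X.phi .minus ρ) x) x :=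
  ((h.differentiableAt .plus ρ hρ x hx).hasDerivAt.const_mul q₁).add
    ((h.differentiableAt .minus ρ hρ x hx).hasDerivAt.const_mul q₂)

theorem derivHasSign_F1 (h : X.HasRegularSolutions l) (hρ : 0 < ρ) (hρb : 0 < ρ + b)
    (hε : ε = 1 ∨ ε = -1) (s : Pm) {c : ℝ} (hc : 0 < c) :
    DerivHasSign X (F1 X s a b ρ ε c) (s.val * ε) := by
  have e : F1 X s a b ρ ε c = fun x => -(a / b) +
      ε * ((fun x => c * X.phi s (ρ + b) x) x / X.phi s.flip ρ x) := by
    funext x; simp only [F1, mul_div_assoc]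
  rw [e]
  refine derivHasSign_quotient (fun x hx => (h.differentiableAt s _ hρb x hx).const_mul c)
    (h.differentiableAt _ _ hρ) (h.pos _ _ hρ) (by cases s <;> simp [Pm.val]) hε ?_
  intro x hx
  rw [deriv_const_mul c (h.differentiableAt s _ hρb x hx)]
  have p1 := h.pos s _ hρb x hx
  have p2 := h.pos s.flip _ hρ x hx
  cases s
  · have d1 := h.deriv_plus_pos _ hρb x hx
    have d2 := h.deriv_minus_neg _ hρ x hx
    have m1 := mul_pos (mul_pos hc d1) p2
    have m2 := mul_pos (mul_pos hc p1) (neg_pos.2 d2)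
    simp only [Pm.val, Pm.flip] at *
    linarith
  · have d1 := h.deriv_minus_neg _ hρb x hx
    have d2 := h.deriv_plus_pos _ hρ x hx
    have m1 := mul_pos (mul_pos hc (neg_pos.2 d1)) p2
    have m2 := mul_pos (mul_pos hc p1) d2
    simp only [Pm.val, Pm.flip] at *
    linarith

/-- Numerator and denominator are solutions of the same type, so the Wronskian inequality in ρ
applies; the sign of b tells which of ρ and ρ + b is the larger parameter. -/
theorem derivHasSign_F2 (h : X.HasRegularSolutions l) (hb : b ≠ 0) (hρ : 0 < ρ) (hρb : 0 < ρ + b)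
    (hε : ε = 1 ∨ ε = -1) (s : Pm) {c : ℝ} (hc : 0 < c) :
    DerivHasSign X (F2 X s a b ρ ε c) (s.val * ε * Real.sign b) := by
  have e : F2 X s a b ρ ε c = fun x => -(a / b) +
      ε * ((fun x => c * X.phi s (ρ + b) x) x / X.phi s ρ x) := by
    funext x; simp only [F2, mul_div_assoc]
  rw [e, mul_right_comm]
  have hsb : Real.sign b = 1 ∨ Real.sign b = -1 := by
    rcases lt_or_gt_of_ne hb with hb | hb
    · exact Or.inr (Real.sign_of_neg hb)
    · exact Or.inl (Real.sign_of_pos hb)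
  refine derivHasSign_quotient (fun x hx => (h.differentiableAt s _ hρb x hx).const_mul c)
    (h.differentiableAt _ _ hρ) (h.pos _ _ hρ) ?_ hε ?_
  · rcases hsb with hsb | hsb <;> cases s <;> simp [Pm.val, hsb]
  intro x hx
  rw [deriv_const_mul c (h.differentiableAt s _ hρb x hx)]
  rcases lt_or_gt_of_ne hb with hb | hb
  · have hlt : ρ + b < ρ := by linarith
    rw [Real.sign_of_neg hb]
    cases s
    · have := mul_lt_mul_of_pos_left (h.wronskian_plus _ _ hρb hlt x hx) hc
      simp only [Pm.val]; linarith
    · have := mul_lt_mul_of_pos_left (h.wronskian_minus _ _ hρb hlt x hx) hc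
      simp only [Pm.val]; linarith
  · have hlt : ρ < ρ + b := by linarith
    rw [Real.sign_of_pos hb]
    cases s
    · have := mul_lt_mul_of_pos_left (h.wronskian_plus _ _ hρ hlt x hx) hc
      simp only [Pm.val]; linarith
    · have := mul_lt_mul_of_pos_left (h.wronskian_minus _ _ hρ hlt x hx) hc
      simp only [Pm.val]; linarith

/-- The Wronskian is linear in the numerator. The term of type opposite to the denominator has the
wanted sign by monotonicity, the other by the Wronskian inequality, and the two agree because ρ + b
< ρ. -/
theorem derivHasSign_F3 (h : X.HasRegularSolutions l) (hb : b < 0) (hρ : 0 < ρ) (hρb : 0 < ρ + b)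
    (hε : ε = 1 ∨ ε = -1) (s : Pm) {c₁ c₂ : ℝ} (hc₁ : 0 < c₁) (hc₂ : 0 < c₂) :
    DerivHasSign X (F3 X s a b ρ ε c₁ c₂) (s.val * ε) := by
  refine derivHasSign_quotient (fun x hx => (h.deriv_combination hρb c₁ c₂ hx).differentiableAt)
    (h.differentiableAt _ _ hρ) (h.pos _ _ hρ) (by cases s <;> simp [Pm.val]) hε ?_
  intro x hx
  rw [(h.deriv_combination hρb c₁ c₂ hx).deriv]
  have hlt : ρ + b < ρ := by linarith
  have p1 := h.pos .plus _ hρb x hx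
  have p2 := h.pos .minus _ hρb x hx
  have d1 := h.deriv_plus_pos _ hρb x hx
  have d2 := h.deriv_minus_neg _ hρb x hx
  cases s
  · have w := mul_lt_mul_of_pos_left (h.wronskian_minus _ _ hρb hlt x hx) hc₂
    have p := h.pos .minus _ hρ x hx
    have d := h.deriv_minus_neg _ hρ x hx
    have m1 := mul_pos (mul_pos hc₁ d1) p
    have m2 := mul_pos (mul_pos hc₁ p1) (neg_pos.2 d)
    simp only [Pm.val, Pm.flip]
    linarith
  · have w := mul_lt_mul_of_pos_left (h.wronskian_plus _ _ hρb hlt x hx) hc₁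
    have p := h.pos .plus _ hρ x hx
    have d := h.deriv_plus_pos _ hρ x hx
    have m1 := mul_pos (mul_pos hc₂ (neg_pos.2 d2)) p
    have m2 := mul_pos (mul_pos hc₂ p2) d
    simp only [Pm.val, Pm.flip]
    linarith

theorem combination_pos (h : X.HasRegularSolutions l) (hρ : 0 < ρ) {q₁ q₂ : ℝ} (hq₁ : 0 ≤ q₁)
    (hq₂ : 0 ≤ q₂) (hq : 0 < q₁ ∨ 0 < q₂) {x : ℝ} (hx : x ∈ X.interval) :
    0 < q₁ * X.phi .plus ρ x + q₂ * X.phi .minus ρ x := by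
  have p1 := h.pos .plus _ hρ x hx
  have p2 := h.pos .minus _ hρ x hx
  rcases hq with hq | hq <;> positivity

/-- Here the Wronskian splits along the denominator; its same-type and opposite-type terms agree in
sign because ρ < ρ + b. -/
theorem derivHasSign_F4 (h : X.HasRegularSolutions l) (hb : 0 < b) (hρ : 0 < ρ) (hρb : 0 < ρ + b)
    (hε : ε = 1 ∨ ε = -1) (s : Pm) {q₁ q₂ : ℝ} (hq₁ : 0 < q₁) (hq₂ : 0 < q₂) :
    DerivHasSign X (F4 X s a b ρ ε q₁ q₂) (s.val * ε) := by
  refine derivHasSign_quotient (h.differentiableAt _ _ hρb)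
    (fun x hx => (h.deriv_combination hρ q₁ q₂ hx).differentiableAt)
    (fun x hx => h.combination_pos hρ hq₁.le hq₂.le (Or.inl hq₁) hx)
    (by cases s <;> simp [Pm.val]) hε ?_
  intro x hx
  rw [(h.deriv_combination hρ q₁ q₂ hx).deriv]
  have hlt : ρ < ρ + b := by linarith
  have p1 := h.pos .plus _ hρ x hx
  have p2 := h.pos .minus _ hρ x hx
  have d1 := h.deriv_plus_pos _ hρ x hx
  have d2 := h.deriv_minus_neg _ hρ x hx
  cases s
  · have w := mul_lt_mul_of_pos_left (h.wronskian_plus _ _ hρ hlt x hx) hq₁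
    have p := h.pos .plus _ hρb x hx
    have d := h.deriv_plus_pos _ hρb x hx
    have m1 := mul_pos (mul_pos hq₂ d) p2
    have m2 := mul_pos (mul_pos hq₂ (neg_pos.2 d2)) p
    simp only [Pm.val]
    linarith
  · have w := mul_lt_mul_of_pos_left (h.wronskian_minus _ _ hρ hlt x hx) hq₂
    have p := h.pos .minus _ hρb x hx
    have d := h.deriv_minus_neg _ hρb x hx
    have m1 := mul_pos (mul_pos hq₁ (neg_pos.2 d)) p1
    have m2 := mul_pos (mul_pos hq₁ d1) p
    simp only [Pm.val]
    linarith

/-- The expansion has four terms, each a product cᵢqⱼ times one of the positive quantities `w1` to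
`w4`. One positive qⱼ already makes a same-type term strictly positive. -/
theorem derivHasSign_F5 (h : X.HasRegularSolutions l) (hb : 0 < b) (hρ : 0 < ρ) (hρb : 0 < ρ + b)
    (hε : ε = 1 ∨ ε = -1) {c₁ c₂ q₁ q₂ : ℝ} (hc₁ : 0 < c₁) (hc₂ : 0 < c₂) (hq₁ : 0 ≤ q₁)
    (hq₂ : 0 ≤ q₂) (hq : 0 < q₁ ∨ 0 < q₂) :
    DerivHasSign X (F5 X a b ρ ε c₁ c₂ q₁ q₂) ε := by
  have e : F5 X a b ρ ε c₁ c₂ q₁ q₂ = fun x => -(a / b) +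
      ε * ((fun x => c₁ * X.phi .plus (ρ + b) x + (-c₂) * X.phi .minus (ρ + b) x) x /
        (q₁ * X.phi .plus ρ x + q₂ * X.phi .minus ρ x)) := by
    funext x; simp only [F5, neg_mul, sub_eq_add_neg]
  suffices hs : DerivHasSign X (F5 X a b ρ ε c₁ c₂ q₁ q₂) (1 * ε) by rwa [one_mul] at hs
  rw [e]
  refine derivHasSign_quotient
    (fun x hx => (h.deriv_combination hρb c₁ (-c₂) hx).differentiableAt)
    (fun x hx => (h.deriv_combination hρ q₁ q₂ hx).differentiableAt)
    (fun x hx => h.combination_pos hρ hq₁ hq₂ hq hx) (Or.inl rfl) hε ?_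
  intro x hx
  rw [(h.deriv_combination hρb c₁ (-c₂) hx).deriv, (h.deriv_combination hρ q₁ q₂ hx).deriv]
  have hlt : ρ < ρ + b := by linarith
  have p1 := h.pos .plus _ hρ x hx
  have p2 := h.pos .minus _ hρ x hx
  have d1 := h.deriv_plus_pos _ hρ x hx
  have d2 := h.deriv_minus_neg _ hρ x hx
  have p1' := h.pos .plus _ hρb x hx
  have p2' := h.pos .minus _ hρb x hx
  have d1' := h.deriv_plus_pos _ hρb x hx
  have d2' := h.deriv_minus_neg _ hρb x hx
  have w1 := sub_pos.2 (h.wronskian_plus _ _ hρ hlt x hx)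
  have w2 := sub_pos.2 (h.wronskian_minus _ _ hρ hlt x hx)
  have w3 : 0 < deriv (X.phi .plus (ρ + b)) x * X.phi .minus ρ x -
      X.phi .plus (ρ + b) x * deriv (X.phi .minus ρ) x := by
    have := mul_pos d1' p2
    have := mul_pos p1' (neg_pos.2 d2)
    linarith
  have w4 : 0 < X.phi .minus (ρ + b) x * deriv (X.phi .plus ρ) x -
      deriv (X.phi .minus (ρ + b)) x * X.phi .plus ρ x := by
    have := mul_pos p2' d1
    have := mul_pos (neg_pos.2 d2') p1
    linarith
  rcases hq with hq | hq
  · have m1 := mul_pos (mul_pos hc₁ hq) w1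
    have m2 := mul_nonneg (mul_nonneg hc₂.le hq₂) w2.le
    have m3 := mul_nonneg (mul_nonneg hc₁.le hq₂) w3.le
    have m4 := mul_nonneg (mul_nonneg hc₂.le hq₁) w4.le
    linarith
  · have m1 := mul_nonneg (mul_nonneg hc₁.le hq₁) w1.le
    have m2 := mul_pos (mul_pos hc₂ hq) w2
    have m3 := mul_nonneg (mul_nonneg hc₁.le hq₂) w3.le
    have m4 := mul_nonneg (mul_nonneg hc₂.le hq₁) w4.le
    linarith

/-! ### Endpoint behaviour and failure of monotonicity for negative b -/

theorem strictMonoOn_plus (h : X.HasRegularSolutions l) (hρ : 0 < ρ) :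
    StrictMonoOn (X.phi .plus ρ) X.interval := by
  refine strictMonoOn_of_deriv_pos X.convex_interval
    (fun x hx => (h.differentiableAt .plus ρ hρ x hx).continuousAt.continuousWithinAt) fun x hx => ?_
  rw [X.isOpen_interval.interior_eq] at hx
  exact h.deriv_plus_pos ρ hρ x hx

theorem minus_ratio_strictMonoOn (h : X.HasRegularSolutions l) {ρ₁ ρ₂ : ℝ} (hρ₁ : 0 < ρ₁)
    (hlt : ρ₁ < ρ₂) :
    StrictMonoOn (fun x => X.phi .minus ρ₁ x / X.phi .minus ρ₂ x) X.interval := by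
  have hρ₂ := hρ₁.trans hlt
  have hd : ∀ x ∈ X.interval, HasDerivAt (fun x => X.phi .minus ρ₁ x / X.phi .minus ρ₂ x)
      ((deriv (X.phi .minus ρ₁) x * X.phi .minus ρ₂ x -
        X.phi .minus ρ₁ x * deriv (X.phi .minus ρ₂) x) / X.phi .minus ρ₂ x ^ 2) x := fun x hx =>
    (h.differentiableAt .minus _ hρ₁ x hx).hasDerivAt.div
      (h.differentiableAt .minus _ hρ₂ x hx).hasDerivAt (h.pos .minus _ hρ₂ x hx).ne'
  refine strictMonoOn_of_deriv_pos X.convex_interval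
    (fun x hx => (hd x hx).continuousAt.continuousWithinAt) fun x hx => ?_
  rw [X.isOpen_interval.interior_eq] at hx
  rw [(hd x hx).deriv]
  refine div_pos ?_ (pow_pos (h.pos .minus _ hρ₂ x hx) 2)
  have := h.wronskian_minus _ _ hρ₁ hlt x hx
  linarith

theorem minus_div_plus_right (h : X.HasRegularSolutions l) {ρ₁ ρ₂ : ℝ} (hρ₁ : 0 < ρ₁)
    (hρ₂ : 0 < ρ₂) : Tendsto (fun x => X.phi .minus ρ₁ x / X.phi .plus ρ₂ x) atTop (𝓝 0) := by
  have h1 : (1 : ℝ) ∈ X.interval := X.mem_interval_of_pos one_pos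
  have hlim : Tendsto (fun x => X.phi .minus ρ₁ x / X.phi .plus ρ₂ 1) atTop (𝓝 0) := by
    simpa using (h.minus_right ρ₁ hρ₁).div_const (X.phi .plus ρ₂ 1)
  refine squeeze_zero' ?_ ?_ hlim
  · filter_upwards [eventually_gt_atTop 0] with x hx
    have hx := X.mem_interval_of_pos hx
    exact (div_pos (h.pos _ _ hρ₁ x hx) (h.pos _ _ hρ₂ x hx)).le
  · filter_upwards [eventually_ge_atTop 1] with x hx
    have hx' := X.mem_interval_of_pos (one_pos.trans_le hx)
    exact div_le_div_of_nonneg_left (h.pos _ _ hρ₁ x hx').le (h.pos _ _ hρ₂ 1 h1)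
      ((h.strictMonoOn_plus hρ₂).monotoneOn h1 hx' hx)

theorem plus_div_minus_left (h : X.HasRegularSolutions l) {ρ₁ ρ₂ : ℝ} (hρ₁ : 0 < ρ₁)
    (hρ₂ : 0 < ρ₂) : Tendsto (fun x => X.phi .plus ρ₁ x / X.phi .minus ρ₂ x) l (𝓝 0) := by
  have h1 : (1 : ℝ) ∈ X.interval := X.mem_interval_of_pos one_pos
  have hlim : Tendsto (fun x => X.phi .plus ρ₁ 1 / X.phi .minus ρ₂ x) l (𝓝 0) :=
    (h.minus_left ρ₂ hρ₂).const_div_atTop _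
  refine squeeze_zero' ?_ ?_ hlim
  · filter_upwards [h.left 1 h1] with x hx
    exact (div_pos (h.pos _ _ hρ₁ x hx.1) (h.pos _ _ hρ₂ x hx.1)).le
  · filter_upwards [h.left 1 h1] with x hx
    exact div_le_div_of_nonneg_right ((h.strictMonoOn_plus hρ₁).monotoneOn hx.1 h1 hx.2.le)
      (h.pos _ _ hρ₂ x hx.1).le

variable {ρ' c₁ c₂ q₁ q₂ : ℝ}

theorem eventually_numerator_pos (h : X.HasRegularSolutions l) (hρ' : 0 < ρ') (hc₁ : 0 < c₁)
    (hc₂ : 0 < c₂) :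
    ∀ᶠ x in atTop, x ∈ X.interval ∧ 0 < c₁ * X.phi .plus ρ' x - c₂ * X.phi .minus ρ' x := by
  filter_upwards [eventually_gt_atTop 0,
    (h.minus_div_plus_right hρ' hρ').eventually (gt_mem_nhds (div_pos hc₁ hc₂))] with x hx hlt
  have hx := X.mem_interval_of_pos hx
  refine ⟨hx, ?_⟩
  rw [div_lt_div_iff₀ (h.pos _ _ hρ' x hx) hc₂] at hlt
  linarith

theorem eventually_numerator_neg (h : X.HasRegularSolutions l) (hρ' : 0 < ρ') (hc₁ : 0 < c₁)
    (hc₂ : 0 < c₂) :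
    ∀ᶠ x in l, x ∈ X.interval ∧ c₁ * X.phi .plus ρ' x - c₂ * X.phi .minus ρ' x < 0 := by
  have h1 : (1 : ℝ) ∈ X.interval := X.mem_interval_of_pos one_pos
  filter_upwards [h.left 1 h1,
    (h.plus_div_minus_left hρ' hρ').eventually (gt_mem_nhds (div_pos hc₂ hc₁))] with x hx hlt
  refine ⟨hx.1, ?_⟩
  rw [div_lt_div_iff₀ (h.pos _ _ hρ' x hx.1) hc₁] at hlt
  linarith

/-- The numerator is positive near +∞ and negative near the left endpoint, whatever the order of the
two parameters. -/
theorem not_strictAntiOn_quotient (h : X.HasRegularSolutions l) (hρ' : 0 < ρ') (hρ : 0 < ρ)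
    (hc₁ : 0 < c₁) (hc₂ : 0 < c₂) (hq₁ : 0 ≤ q₁) (hq₂ : 0 ≤ q₂) (hq : 0 < q₁ ∨ 0 < q₂) :
    ¬ StrictAntiOn (fun x => (c₁ * X.phi .plus ρ' x - c₂ * X.phi .minus ρ' x) /
      (q₁ * X.phi .plus ρ x + q₂ * X.phi .minus ρ x)) X.interval := by
  intro hanti
  have := h.neBot
  obtain ⟨x, hx, hxp⟩ := (h.eventually_numerator_pos hρ' hc₁ hc₂).exists
  obtain ⟨y, ⟨hy, hyx⟩, -, hyn⟩ :=
    ((h.left x hx).and (h.eventually_numerator_neg hρ' hc₁ hc₂)).exists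
  have h1 := div_pos hxp (h.combination_pos hρ hq₁ hq₂ hq hx)
  have h2 := div_neg_of_neg_of_pos hyn (h.combination_pos hρ hq₁ hq₂ hq hy)
  have h3 := hanti hy hx hyx
  simp only at h3
  linarith

/-- After division by φ⁺_ρ the numerator tends to 0 and the denominator to q₁ > 0. A strictly
increasing function with limit 0 at +∞ cannot take a positive value, yet this quotient does. -/
theorem not_strictMonoOn_quotient_of_pos (h : X.HasRegularSolutions l) (hρ' : 0 < ρ')
    (hlt : ρ' < ρ) (hc₁ : 0 < c₁) (hc₂ : 0 < c₂) (hq₁ : 0 < q₁) (hq₂ : 0 ≤ q₂) :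
    ¬ StrictMonoOn (fun x => (c₁ * X.phi .plus ρ' x - c₂ * X.phi .minus ρ' x) /
      (q₁ * X.phi .plus ρ x + q₂ * X.phi .minus ρ x)) X.interval := by
  intro hmono
  have hρ := hρ'.trans hlt
  obtain ⟨x, hx, hxp⟩ := (h.eventually_numerator_pos hρ' hc₁ hc₂).exists
  have h1 := div_pos hxp (h.combination_pos hρ hq₁.le hq₂ (Or.inl hq₁) hx)
  have hnum := ((h.plus_ratio_right ρ' ρ hρ' hlt).const_mul c₁).sub
    ((h.minus_div_plus_right hρ' hρ).const_mul c₂)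
  have hden := ((h.minus_div_plus_right hρ hρ).const_mul q₂).const_add q₁
  have hlim := hnum.div hden (by simpa using hq₁.ne')
  simp only [mul_zero, sub_zero, add_zero, zero_div] at hlim
  have hge : (c₁ * X.phi .plus ρ' x - c₂ * X.phi .minus ρ' x) /
      (q₁ * X.phi .plus ρ x + q₂ * X.phi .minus ρ x) ≤ 0 := by
    refine ge_of_tendsto hlim ?_
    filter_upwards [eventually_gt_atTop x, eventually_gt_atTop 0] with y hy hy0
    have hyI := X.mem_interval_of_pos hy0
    have h3 := hmono hx hyI hy
    have hp := h.pos .plus _ hρ y hyI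
    refine h3.le.trans (le_of_eq ?_)
    simp only [Pi.div_apply]
    rw [← div_div_div_cancel_right₀ hp.ne']
    congr 1 <;> field_simp
  linarith

/-- The quotient tends to −c₂r/q₂ at the left endpoint. An increasing function stays above this
limit, which amounts to `key`; there the left side tends to infinity at that endpoint while the
right side stays bounded. -/
theorem not_strictMonoOn_quotient_of_zero (h : X.HasRegularSolutions l) (hX : X.IsOUOrOneLeMu)
    (hρ' : 0 < ρ') (hlt : ρ' < ρ) (hc₁ : 0 < c₁) (hc₂ : 0 < c₂) (hq₂ : 0 < q₂) :
    ¬ StrictMonoOn (fun x => (c₁ * X.phi .plus ρ' x - c₂ * X.phi .minus ρ' x) /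
      (0 * X.phi .plus ρ x + q₂ * X.phi .minus ρ x)) X.interval := by
  intro hmono
  have := h.neBot
  have hρ := hρ'.trans hlt
  obtain ⟨r, hr1, hr2⟩ := h.minus_ratio_left hX ρ' ρ hρ' hlt
  have h1 : (1 : ℝ) ∈ X.interval := X.mem_interval_of_pos one_pos
  have hlim := (((h.plus_div_minus_left hρ' hρ).const_mul c₁).sub (hr1.const_mul c₂)).div_const q₂
  rw [mul_zero, zero_sub] at hlim
  have key : ∀ x ∈ X.interval,
      c₂ * (X.phi .minus ρ' x - r * X.phi .minus ρ x) ≤ c₁ * X.phi .plus ρ' x := by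
    intro x hx
    have hge : -(c₂ * r) / q₂ ≤ (c₁ * X.phi .plus ρ' x - c₂ * X.phi .minus ρ' x) /
        (0 * X.phi .plus ρ x + q₂ * X.phi .minus ρ x) := by
      refine le_of_tendsto hlim ?_
      filter_upwards [h.left x hx] with y hy
      refine le_trans (le_of_eq ?_) (hmono hy.1 hx hy.2).le
      have hp := h.pos .minus _ hρ y hy.1
      simp only [zero_mul, zero_add]
      field_simp
    have hp := h.pos .minus _ hρ x hx
    rw [zero_mul, zero_add, div_le_div_iff₀ hq₂ (mul_pos hq₂ hp)] at hge
    have : (-(c₂ * r) * X.phi .minus ρ x) * q₂ ≤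
        (c₁ * X.phi .plus ρ' x - c₂ * X.phi .minus ρ' x) * q₂ := by linarith
    have := le_of_mul_le_mul_right this hq₂
    linarith
  obtain ⟨y, hy, hyl⟩ := ((h.left 1 h1).and
    (hr2.eventually_gt_atTop (c₁ * X.phi .plus ρ' 1 / c₂))).exists
  rw [div_lt_iff₀ hc₂] at hyl
  have h2 := key y hy.1
  have h3 := mul_le_mul_of_nonneg_left
    ((h.strictMonoOn_plus hρ').monotoneOn hy.1 h1 hy.2.le) hc₁.le
  linarith

/-- Serves q₁ = 0 without a condition on the diffusion: since φ⁻_{ρ'}/φ⁻_ρ is strictly increasing,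
subtracting a large enough multiple of it produces a decrease between the points 1 and 2. -/
theorem exists_not_strictMonoOn_quotient (h : X.HasRegularSolutions l) (hρ' : 0 < ρ')
    (hlt : ρ' < ρ) (hq₂ : 0 < q₂) : ∃ c₂ : ℝ, 0 < c₂ ∧
    ¬ StrictMonoOn (fun x => (1 * X.phi .plus ρ' x - c₂ * X.phi .minus ρ' x) /
      (0 * X.phi .plus ρ x + q₂ * X.phi .minus ρ x)) X.interval := by
  have hρ := hρ'.trans hlt
  have h1 : (1 : ℝ) ∈ X.interval := X.mem_interval_of_pos one_pos
  have h2 : (2 : ℝ) ∈ X.interval := X.mem_interval_of_pos two_pos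
  have hR := h.minus_ratio_strictMonoOn hρ' hlt h1 h2 one_lt_two
  simp only at hR
  have p1 := h.pos .minus _ hρ 1 h1
  have p2 := h.pos .minus _ hρ 2 h2
  set A := X.phi .plus ρ' 2 / X.phi .minus ρ 2 - X.phi .plus ρ' 1 / X.phi .minus ρ 1 with hA
  set B := X.phi .minus ρ' 2 / X.phi .minus ρ 2 - X.phi .minus ρ' 1 / X.phi .minus ρ 1 with hB
  have hBpos : 0 < B := sub_pos.2 hR
  refine ⟨(|A| + 1) / B, div_pos (by positivity) hBpos, fun hmono => ?_⟩
  have hm := hmono h1 h2 one_lt_two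
  simp only [zero_mul, zero_add, one_mul] at hm
  have e : ∀ x ∈ X.interval, (X.phi .plus ρ' x - (|A| + 1) / B * X.phi .minus ρ' x) /
      (q₂ * X.phi .minus ρ x) = q₂⁻¹ * (X.phi .plus ρ' x / X.phi .minus ρ x -
        (|A| + 1) / B * (X.phi .minus ρ' x / X.phi .minus ρ x)) := by
    intro x hx
    have := h.pos .minus _ hρ x hx
    field_simp
  rw [e 1 h1, e 2 h2] at hm
  have hm := lt_of_mul_lt_mul_left hm (inv_pos.2 hq₂).le
  have hk : (|A| + 1) / B * B = |A| + 1 := div_mul_cancel₀ _ hBpos.ne'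
  rw [hB, mul_sub] at hk
  have := le_abs_self A
  linarith

theorem strictlyMonotonic_F5_iff (h : X.HasRegularSolutions l) (hb : b ≠ 0) (hρ : 0 < ρ)
    (hρb : 0 < ρ + b) (hε : ε = 1 ∨ ε = -1) (hc₁ : 0 < c₁) (hc₂ : 0 < c₂) (hq₁ : 0 ≤ q₁)
    (hq₂ : 0 ≤ q₂) (hq : 0 < q₁ ∨ 0 < q₂) (hX : 0 < q₁ ∨ X.IsOUOrOneLeMu) :
    StrictlyMonotonic X (F5 X a b ρ ε c₁ c₂ q₁ q₂) ↔ 0 < b := by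
  refine ⟨fun hmono => ?_, fun hb =>
    (h.derivHasSign_F5 hb hρ hρb hε hc₁ hc₂ hq₁ hq₂ hq).strictlyMonotonic hε⟩
  by_contra hb'
  have hlt : ρ + b < ρ := by
    have := lt_of_le_of_ne (not_lt.1 hb') hb
    linarith
  rcases (strictlyMonotonic_affine_iff hε).1 hmono with hm | hm
  · rcases hq₁.eq_or_lt with rfl | hq₁'
    · exact h.not_strictMonoOn_quotient_of_zero (hX.resolve_left (lt_irrefl _)) hρb hlt hc₁ hc₂
        (hq.resolve_left (lt_irrefl _)) hm
    · exact h.not_strictMonoOn_quotient_of_pos hρb hlt hc₁ hc₂ hq₁' hq₂ hm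
  · exact h.not_strictAntiOn_quotient hρb hρ hc₁ hc₂ hq₁ hq₂ hq hm

theorem forall_strictlyMonotonic_F5_iff (h : X.HasRegularSolutions l) (hb : b ≠ 0) (hρ : 0 < ρ)
    (hρb : 0 < ρ + b) (hε : ε = 1 ∨ ε = -1) (hq₁ : 0 ≤ q₁) (hq₂ : 0 ≤ q₂)
    (hq : 0 < q₁ ∨ 0 < q₂) :
    (∀ c₁ c₂ : ℝ, 0 < c₁ → 0 < c₂ → StrictlyMonotonic X (F5 X a b ρ ε c₁ c₂ q₁ q₂)) ↔ 0 < b := by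
  refine ⟨fun hmono => ?_, fun hb c₁ c₂ hc₁ hc₂ =>
    (h.derivHasSign_F5 hb hρ hρb hε hc₁ hc₂ hq₁ hq₂ hq).strictlyMonotonic hε⟩
  rcases hq₁.eq_or_lt with rfl | hq₁'
  · by_contra hb'
    have hlt : ρ + b < ρ := by
      have := lt_of_le_of_ne (not_lt.1 hb') hb
      linarith
    obtain ⟨c₂, hc₂, hnot⟩ :=
      h.exists_not_strictMonoOn_quotient hρb hlt (hq.resolve_left (lt_irrefl _))
    rcases (strictlyMonotonic_affine_iff hε).1 (hmono 1 c₂ one_pos hc₂) with hm | hm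
    · exact hnot hm
    · exact h.not_strictAntiOn_quotient hρb hρ one_pos hc₂ le_rfl hq₂ hq hm
  · exact (h.strictlyMonotonic_F5_iff hb hρ hρb hε one_pos one_pos hq₁ hq₂ hq (Or.inl hq₁')).1
      (hmono 1 1 one_pos one_pos)

end Diffusion.HasRegularSolutions

/-- The functions `φ ρ`, `ρ > 0`, are positive multiples of exponential integrals of weights `w ρ`
in the variable `u x`, and the quotients `w ρ₂ / w ρ₁` with `ρ₁ < ρ₂` increase with `Y`. -/
structure IsExpRepr {Ω : Type*} [MeasurableSpace Ω] (I : Set ℝ) (φ : ℝ → ℝ → ℝ) (m : Measure Ω)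
    (Y : Ω → ℝ) (U : Set ℝ) (w : ℝ → Ω → ℝ) (C : ℝ → ℝ) (u u' : ℝ → ℝ) : Prop where
  isOpen : IsOpen I
  isOpen_param : IsOpen U
  unbounded : IsUnboundedNonneg m Y
  weight : ∀ ρ, 0 < ρ → IsExpWeight m Y U (w ρ)
  const_pos : ∀ ρ, 0 < ρ → 0 < C ρ
  hasDerivAt : ∀ x ∈ I, HasDerivAt u (u' x) x
  mem : ∀ x ∈ I, u x ∈ U
  eq : ∀ ρ, 0 < ρ → ∀ x ∈ I, φ ρ x = C ρ * expInt m Y (w ρ) (u x)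
  separated : ∀ ρ₁ ρ₂, 0 < ρ₁ → ρ₁ < ρ₂ → ∀ a : ℝ, 0 < a → ∃ γ : ℝ, ∀ᵐ ω ∂m,
    (Y ω ≤ a → w ρ₂ ω ≤ γ * w ρ₁ ω) ∧ (a < Y ω → γ * w ρ₁ ω < w ρ₂ ω)

/-! ### Transfer from exponential integrals to fundamental solutions -/

namespace IsExpRepr

variable {Ω : Type*} [MeasurableSpace Ω] {I : Set ℝ} {φ : ℝ → ℝ → ℝ} {m : Measure Ω}
  {Y : Ω → ℝ} {U : Set ℝ} {w : ℝ → Ω → ℝ} {C u u' : ℝ → ℝ} {ρ ρ₁ ρ₂ x : ℝ}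

theorem pos (h : IsExpRepr I φ m Y U w C u u') (hρ : 0 < ρ) (hx : x ∈ I) : 0 < φ ρ x := by
  rw [h.eq ρ hρ x hx]
  exact mul_pos (h.const_pos ρ hρ) ((h.weight ρ hρ).expInt_pos h.unbounded (h.mem x hx))

theorem hasDerivAt_phi (h : IsExpRepr I φ m Y U w C u u') (hρ : 0 < ρ) (hx : x ∈ I) :
    HasDerivAt (φ ρ) (C ρ * (deriv (expInt m Y (w ρ)) (u x) * u' x)) x := by
  have h1 := ((h.weight ρ hρ).differentiableAt_expInt h.isOpen_param (h.mem x hx)).hasDerivAt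
  have h2 := (h1.comp x (h.hasDerivAt x hx)).const_mul (C ρ)
  refine h2.congr_of_eventuallyEq ?_
  filter_upwards [h.isOpen.mem_nhds hx] with y hy
  exact h.eq ρ hρ y hy

theorem deriv_pos (h : IsExpRepr I φ m Y U w C u u') (hρ : 0 < ρ) (hx : x ∈ I) (hu : 0 < u' x) :
    0 < deriv (φ ρ) x := by
  rw [(h.hasDerivAt_phi hρ hx).deriv]
  exact mul_pos (h.const_pos ρ hρ) (mul_pos
    ((h.weight ρ hρ).deriv_expInt_pos h.isOpen_param h.unbounded (h.mem x hx)) hu)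

theorem deriv_neg (h : IsExpRepr I φ m Y U w C u u') (hρ : 0 < ρ) (hx : x ∈ I) (hu : u' x < 0) :
    deriv (φ ρ) x < 0 := by
  rw [(h.hasDerivAt_phi hρ hx).deriv]
  exact mul_neg_of_pos_of_neg (h.const_pos ρ hρ) (mul_neg_of_pos_of_neg
    ((h.weight ρ hρ).deriv_expInt_pos h.isOpen_param h.unbounded (h.mem x hx)) hu)

/-- The chain rule multiplies the comparison of logarithmic derivatives by u'. One statement thus
serves φ⁺, where u increases, and φ⁻, where it decreases. -/
theorem wronskian (h : IsExpRepr I φ m Y U w C u u') (hρ₁ : 0 < ρ₁) (hlt : ρ₁ < ρ₂) (hx : x ∈ I) :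
    ∃ W : ℝ, 0 < W ∧ deriv (φ ρ₂) x * φ ρ₁ x - deriv (φ ρ₁) x * φ ρ₂ x = W * u' x := by
  have hρ₂ := hρ₁.trans hlt
  have h1 := deriv_expInt_mul_lt (h.weight ρ₁ hρ₁) (h.weight ρ₂ hρ₂) h.isOpen_param h.unbounded
    (h.separated ρ₁ ρ₂ hρ₁ hlt) (h.mem x hx)
  refine ⟨_, mul_pos (mul_pos (h.const_pos ρ₁ hρ₁) (h.const_pos ρ₂ hρ₂)) (sub_pos.2 h1), ?_⟩
  rw [(h.hasDerivAt_phi hρ₁ hx).deriv, (h.hasDerivAt_phi hρ₂ hx).deriv, h.eq ρ₁ hρ₁ x hx,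
    h.eq ρ₂ hρ₂ x hx]
  ring

/-- The quotients of the represented functions have the limit of the quotients of the exponential
integrals, up to the constants. -/
theorem tendsto_div (h : IsExpRepr I φ m Y U w C u u') (hρ₁ : 0 < ρ₁) (hρ₂ : 0 < ρ₂)
    {l L : Filter ℝ} (hl : ∀ᶠ x in l, x ∈ I) (hu : Tendsto u l L) {r : ℝ}
    (hr : Tendsto (fun s => expInt m Y (w ρ₁) s / expInt m Y (w ρ₂) s) L (𝓝 r)) :
    Tendsto (fun x => φ ρ₁ x / φ ρ₂ x) l (𝓝 (C ρ₁ / C ρ₂ * r)) := by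
  refine ((hr.comp hu).const_mul (C ρ₁ / C ρ₂)).congr' ?_
  filter_upwards [hl] with x hx
  rw [h.eq ρ₁ hρ₁ x hx, h.eq ρ₂ hρ₂ x hx, Function.comp_apply, div_mul_div_comm]

theorem tendsto_sub_atTop (h : IsExpRepr I φ m Y U w C u u') (hρ₁ : 0 < ρ₁) (hρ₂ : 0 < ρ₂)
    {l L : Filter ℝ} (hl : ∀ᶠ x in l, x ∈ I) (hu : Tendsto u l L)
    (hL : Tendsto (fun s => expInt m Y (w ρ₁) s - expInt m Y (w ρ₂) s) L atTop) :
    Tendsto (fun x => φ ρ₁ x - C ρ₁ / C ρ₂ * φ ρ₂ x) l atTop := by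
  refine ((hL.comp hu).const_mul_atTop (h.const_pos ρ₁ hρ₁)).congr' ?_
  filter_upwards [hl] with x hx
  have := (h.const_pos ρ₂ hρ₂).ne'
  rw [h.eq ρ₁ hρ₁ x hx, h.eq ρ₂ hρ₂ x hx, Function.comp_apply]
  field_simp

theorem tendsto_zero (h : IsExpRepr I φ m Y U w C u u') (hρ : 0 < ρ) {l L : Filter ℝ}
    (hl : ∀ᶠ x in l, x ∈ I) (hu : Tendsto u l L) (hL : Tendsto (expInt m Y (w ρ)) L (𝓝 0)) :
    Tendsto (φ ρ) l (𝓝 0) := by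
  have := (hL.comp hu).const_mul (C ρ)
  rw [mul_zero] at this
  refine this.congr' ?_
  filter_upwards [hl] with x hx
  exact (h.eq ρ hρ x hx).symm

theorem tendsto_atTop (h : IsExpRepr I φ m Y U w C u u') (hρ : 0 < ρ) {l L : Filter ℝ}
    (hl : ∀ᶠ x in l, x ∈ I) (hu : Tendsto u l L) (hL : Tendsto (expInt m Y (w ρ)) L atTop) :
    Tendsto (φ ρ) l atTop := by
  refine ((hL.comp hu).const_mul_atTop (h.const_pos ρ hρ)).congr' ?_
  filter_upwards [hl] with x hx
  exact (h.eq ρ hρ x hx).symm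

end IsExpRepr

/-- Positivity, differentiability, monotonicity and Wronskians follow from the representations
alone. The limits at the endpoints depend on the weights and remain hypotheses. -/
theorem Diffusion.hasRegularSolutions_of_isExpRepr {X : Diffusion} {l : Filter ℝ}
    {Ω : Type*} [MeasurableSpace Ω] {m : Measure Ω} {Y : Ω → ℝ} {U : Set ℝ} {w : ℝ → Ω → ℝ}
    {C u u' : ℝ → ℝ}
    {Ω' : Type*} [MeasurableSpace Ω'] {m' : Measure Ω'} {Z : Ω' → ℝ} {V : Set ℝ}
    {w' : ℝ → Ω' → ℝ} {D v v' : ℝ → ℝ}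
    (hP : IsExpRepr X.interval (X.phi .plus) m Y U w C u u')
    (hM : IsExpRepr X.interval (X.phi .minus) m' Z V w' D v v')
    (hu : ∀ x ∈ X.interval, 0 < u' x) (hv : ∀ x ∈ X.interval, v' x < 0)
    (neBot : l.NeBot)
    (left : ∀ x ∈ X.interval, ∀ᶠ y in l, y ∈ X.interval ∧ y < x)
    (minus_left : ∀ ρ, 0 < ρ → Tendsto (X.phi .minus ρ) l atTop)
    (minus_right : ∀ ρ, 0 < ρ → Tendsto (X.phi .minus ρ) atTop (𝓝 0))
    (plus_ratio_right : ∀ ρ₁ ρ₂, 0 < ρ₁ → ρ₁ < ρ₂ →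
      Tendsto (fun x => X.phi .plus ρ₁ x / X.phi .plus ρ₂ x) atTop (𝓝 0))
    (minus_ratio_left : X.IsOUOrOneLeMu → ∀ ρ₁ ρ₂, 0 < ρ₁ → ρ₁ < ρ₂ → ∃ r : ℝ,
      Tendsto (fun x => X.phi .minus ρ₁ x / X.phi .minus ρ₂ x) l (𝓝 r) ∧
      Tendsto (fun x => X.phi .minus ρ₁ x - r * X.phi .minus ρ₂ x) l atTop) :
    X.HasRegularSolutions l where
  neBot := neBot
  left := left
  pos := by
    rintro (_ | _) ρ hρ x hx
    exacts [hP.pos hρ hx, hM.pos hρ hx]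
  differentiableAt := by
    rintro (_ | _) ρ hρ x hx
    exacts [(hP.hasDerivAt_phi hρ hx).differentiableAt, (hM.hasDerivAt_phi hρ hx).differentiableAt]
  deriv_plus_pos ρ hρ x hx := hP.deriv_pos hρ hx (hu x hx)
  deriv_minus_neg ρ hρ x hx := hM.deriv_neg hρ hx (hv x hx)
  wronskian_plus ρ₁ ρ₂ hρ hlt x hx := by
    obtain ⟨W, hW, e⟩ := hP.wronskian hρ hlt hx
    have := mul_pos hW (hu x hx)
    linarith
  wronskian_minus ρ₁ ρ₂ hρ hlt x hx := by
    obtain ⟨W, hW, e⟩ := hM.wronskian hρ hlt hx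
    have := mul_neg_of_pos_of_neg hW (hv x hx)
    linarith
  minus_left := minus_left
  minus_right := minus_right
  plus_ratio_right := plus_ratio_right
  minus_ratio_left := minus_ratio_left

/-! ### Weights on the half-line -/

theorem isUnboundedNonneg_id : IsUnboundedNonneg (volume.restrict (Set.Ioi (0 : ℝ))) id where
  measurable := measurable_id
  nonneg := by
    filter_upwards [ae_restrict_mem measurableSet_Ioi] with t ht
    exact le_of_lt ht
  unbounded K := by
    have hs : Set.Ioi (max K 0) ⊆ {ω : ℝ | K < id ω} ∩ Set.Ioi 0 := fun t ht =>
      ⟨(le_max_left K 0).trans_lt ht, (le_max_right K 0).trans_lt ht⟩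
    rw [Measure.restrict_apply' measurableSet_Ioi]
    intro h
    have := measure_mono_null hs h
    simp at this

/-- The weight `B e^{-p h}`. -/
noncomputable def expFamily (B h : ℝ → ℝ) (p t : ℝ) : ℝ := B t * Real.exp (-(p * h t))

section ExpFamily

variable {B h : ℝ → ℝ} {p p₁ p₂ : ℝ} {U : Set ℝ}

theorem expFamily_pos (hB : ∀ t, 0 < t → 0 < B t) {t : ℝ} (ht : 0 < t) : 0 < expFamily B h p t :=
  mul_pos (hB t ht) (Real.exp_pos _)

theorem expFamily_eq_mul (t : ℝ) :
    expFamily B h p₁ t = Real.exp ((p₂ - p₁) * h t) * expFamily B h p₂ t := by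
  unfold expFamily
  rw [mul_left_comm, ← Real.exp_add]
  ring_nf

theorem isExpWeight_expFamily (hBm : Measurable B) (hhm : Measurable h)
    (hB : ∀ t, 0 < t → 0 < B t)
    (hint : ∀ s ∈ U, IntegrableOn (fun t => Real.exp (s * t) * expFamily B h p t) (Set.Ioi 0)) :
    IsExpWeight (volume.restrict (Set.Ioi (0 : ℝ))) id U (expFamily B h p) where
  measurable := hBm.mul ((hhm.const_mul p).neg.exp)
  pos := by
    filter_upwards [ae_restrict_mem measurableSet_Ioi] with t ht
    exact expFamily_pos hB ht
  integrable := hint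

theorem expFamily_separated (hB : ∀ t, 0 < t → 0 < B t) (hh : StrictAntiOn h (Set.Ioi 0))
    (hlt : p₁ < p₂) (a : ℝ) (ha : 0 < a) : ∃ γ : ℝ, ∀ᵐ t ∂(volume.restrict (Set.Ioi (0 : ℝ))),
      (id t ≤ a → expFamily B h p₂ t ≤ γ * expFamily B h p₁ t) ∧
      (a < id t → γ * expFamily B h p₁ t < expFamily B h p₂ t) := by
  -- The quotient of the weights is exp((p₁ − p₂)h), increasing because h decreases; γ is its value
  -- at a.
  refine ⟨Real.exp ((p₁ - p₂) * h a), ?_⟩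
  filter_upwards [ae_restrict_mem measurableSet_Ioi] with t ht
  have hp := expFamily_pos (h := h) (p := p₁) hB ht
  rw [expFamily_eq_mul (p₁ := p₂) (p₂ := p₁) t]
  constructor
  · intro hta
    refine mul_le_mul_of_nonneg_right (Real.exp_le_exp.2 ?_) hp.le
    have := hh.antitoneOn ht ha hta
    nlinarith
  · intro hta
    refine mul_lt_mul_of_pos_right (Real.exp_lt_exp.2 ?_) hp
    have := hh ha ht hta
    nlinarith

theorem expFamily_tendsto_atTop (hw : IsExpWeight (volume.restrict (Set.Ioi (0 : ℝ))) id
      (Set.Iio 0) (expFamily B h p)) (hp : 0 < p) (hh : StrictAntiOn h (Set.Ioi 0))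
    {b : ℝ} (hb : 0 < b) (hBlow : ∀ t, 1 ≤ t → b / t ≤ B t) :
    Tendsto (expInt (volume.restrict (Set.Ioi 0)) id (expFamily B h p)) (𝓝[<] 0) atTop := by
  refine hw.tendsto_expInt_nhdsLT_zero (c := b * Real.exp (-(p * h 1))) (by positivity) ?_
  intro t ht
  have h1 := hh.antitoneOn (Set.mem_Ioi.2 one_pos) (Set.mem_Ioi.2 (one_pos.trans_le ht)) ht
  have h2 : Real.exp (-(p * h 1)) ≤ Real.exp (-(p * h t)) := Real.exp_le_exp.2 (by nlinarith)
  have h3 := hBlow t ht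
  have h4 : 0 ≤ b / t := div_nonneg hb.le (by linarith)
  calc b * Real.exp (-(p * h 1)) / t = b / t * Real.exp (-(p * h 1)) := by ring
    _ ≤ B t * Real.exp (-(p * h t)) := mul_le_mul h3 h2 (Real.exp_pos _).le (h4.trans h3)

/-- If `h` decays exactly like `1 / t` and `B` is bounded below, then the Laplace transforms of two
members of the family are asymptotically equal at the origin, but their difference blows up. -/
theorem expFamily_ratio (hB : ∀ t, 0 < t → 0 < B t)
    (hw₁ : IsExpWeight (volume.restrict (Set.Ioi (0 : ℝ))) id (Set.Iio 0) (expFamily B h p₁))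
    (hw₂ : IsExpWeight (volume.restrict (Set.Ioi (0 : ℝ))) id (Set.Iio 0) (expFamily B h p₂))
    (hp₁ : 0 < p₁) (hlt : p₁ < p₂) (hh : StrictAntiOn h (Set.Ioi 0))
    (hh0 : Tendsto h atTop (𝓝 0)) (hhpos : ∀ t, 0 < t → 0 < h t)
    {c : ℝ} (hc : 0 < c) (hhlow : ∀ t, 1 ≤ t → c / t ≤ h t)
    {b : ℝ} (hb : 0 < b) (hBlow : ∀ t, 1 ≤ t → b ≤ B t) :
    Tendsto (fun s => expInt (volume.restrict (Set.Ioi 0)) id (expFamily B h p₁) s /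
      expInt (volume.restrict (Set.Ioi 0)) id (expFamily B h p₂) s) (𝓝[<] 0) (𝓝 1) ∧
    Tendsto (fun s => expInt (volume.restrict (Set.Ioi 0)) id (expFamily B h p₁) s -
      expInt (volume.restrict (Set.Ioi 0)) id (expFamily B h p₂) s) (𝓝[<] 0) atTop := by
  set m : Measure ℝ := volume.restrict (Set.Ioi (0 : ℝ)) with hm
  -- The difference is itself a positive weight, (exp((p₂ − p₁)h) − 1) times the second one. It is
  -- at least a constant over t for t ≥ 1, so its transform blows up; the factor tends to 0 at
  -- infinity, so the transform is negligible against the second.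
  set w : ℝ → ℝ := fun t => expFamily B h p₁ t - expFamily B h p₂ t with hw
  have hδ : 0 < p₂ - p₁ := sub_pos.2 hlt
  have hwe : ∀ t, w t = (Real.exp ((p₂ - p₁) * h t) - 1) * expFamily B h p₂ t := by
    intro t
    simp only [hw]
    rw [expFamily_eq_mul (p₁ := p₁) (p₂ := p₂) t]; ring
  have hww : IsExpWeight m id (Set.Iio 0) w :=
    { measurable := hw₁.measurable.sub hw₂.measurable
      pos := by
        filter_upwards [ae_restrict_mem measurableSet_Ioi] with t ht
        rw [hwe]
        refine mul_pos (sub_pos.2 (Real.one_lt_exp_iff.2 (mul_pos hδ (hhpos t ht))))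
          (expFamily_pos hB ht)
      integrable := fun s hs => by
        refine ((hw₁.integrable s hs).sub (hw₂.integrable s hs)).congr ?_
        refine Eventually.of_forall fun t => ?_
        simp only [hw, Pi.sub_apply, mul_sub] }
  have hsub : ∀ s ∈ Set.Iio (0 : ℝ), expInt m id w s =
      expInt m id (expFamily B h p₁) s - expInt m id (expFamily B h p₂) s := by
    intro s hs
    unfold expInt
    rw [← integral_sub (hw₁.integrable s hs) (hw₂.integrable s hs)]
    simp only [hw, mul_sub]
  have hBlow' : ∀ t, 1 ≤ t → b / t ≤ B t := fun t ht =>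
    (div_le_self hb.le ht).trans (hBlow t ht)
  have htop : Tendsto (expInt m id w) (𝓝[<] 0) atTop := by
    refine hww.tendsto_expInt_nhdsLT_zero
      (c := (p₂ - p₁) * c * (b * Real.exp (-(p₂ * h 1)))) (by positivity) ?_
    intro t ht
    have ht0 := one_pos.trans_le ht
    have h1 := hh.antitoneOn (Set.mem_Ioi.2 one_pos) (Set.mem_Ioi.2 ht0) ht
    have h2 : Real.exp (-(p₂ * h 1)) ≤ Real.exp (-(p₂ * h t)) :=
      Real.exp_le_exp.2 (by nlinarith)
    have h3 := hBlow t ht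
    have h4 : (p₂ - p₁) * (c / t) ≤ Real.exp ((p₂ - p₁) * h t) - 1 := by
      have := Real.add_one_le_exp ((p₂ - p₁) * h t)
      have := mul_le_mul_of_nonneg_left (hhlow t ht) hδ.le
      linarith
    have h5 : 0 ≤ (p₂ - p₁) * (c / t) := by positivity
    rw [hwe]
    calc (p₂ - p₁) * c * (b * Real.exp (-(p₂ * h 1))) / t
        = (p₂ - p₁) * (c / t) * (b * Real.exp (-(p₂ * h 1))) := by ring
      _ ≤ (Real.exp ((p₂ - p₁) * h t) - 1) * (B t * Real.exp (-(p₂ * h t))) := by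
        refine mul_le_mul h4 ?_ (by positivity) (h5.trans h4)
        exact mul_le_mul h3 h2 (Real.exp_pos _).le (hb.le.trans h3)
  have hzero : Tendsto (fun s => expInt m id w s / expInt m id (expFamily B h p₂) s)
      (𝓝[<] 0) (𝓝 0) := by
    refine tendsto_expInt_div_zero hww hw₂ isUnboundedNonneg_id ?_ (s₀ := -1) (by simp) ?_ ?_
    · intro δ hδ'
      have hlim : Tendsto (fun t => Real.exp ((p₂ - p₁) * h t) - 1) atTop (𝓝 0) := by
        have := ((Real.continuous_exp.tendsto _).comp (hh0.const_mul (p₂ - p₁))).sub_const 1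
        simpa using this
      obtain ⟨K, hK⟩ := eventually_atTop.1 (hlim.eventually (gt_mem_nhds hδ'))
      refine ⟨K, ?_⟩
      filter_upwards [ae_restrict_mem measurableSet_Ioi] with t ht htK
      rw [hwe]
      exact mul_le_mul_of_nonneg_right (hK t (le_of_lt htK)).le (expFamily_pos hB ht).le
    · filter_upwards [self_mem_nhdsWithin,
        nhdsWithin_le_nhds (Ioi_mem_nhds (by norm_num : (-1 : ℝ) < 0))] with s h1 h2
      exact ⟨h1, le_of_lt h2⟩
    · intro K
      have h1 : Tendsto (fun s : ℝ => Real.exp (s * K)) (𝓝[<] 0) (𝓝 (Real.exp (0 * K))) :=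
        (Continuous.tendsto (by fun_prop) 0).mono_left nhdsWithin_le_nhds
      exact h1.div_atTop (expFamily_tendsto_atTop hw₂ (hp₁.trans hlt) hh hb hBlow')
  constructor
  · have := hzero.add_const 1
    rw [zero_add] at this
    refine this.congr' ?_
    filter_upwards [self_mem_nhdsWithin] with s hs
    have hp := hw₂.expInt_pos isUnboundedNonneg_id hs
    rw [hsub s hs, sub_div, div_self hp.ne']
    ring
  · refine htop.congr' ?_
    filter_upwards [self_mem_nhdsWithin] with s hs
    exact hsub s hs

end ExpFamily

/-! ### Power series -/

theorem isUnboundedNonneg_natCast :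
    IsUnboundedNonneg (Measure.count : Measure ℕ) (fun n => (n : ℝ)) where
  measurable := measurable_from_top
  nonneg := Eventually.of_forall fun n => n.cast_nonneg
  unbounded K := by
    rw [Ne, Measure.count_eq_zero_iff]
    obtain ⟨n, hn⟩ := exists_nat_gt K
    exact Set.Nonempty.ne_empty ⟨n, hn⟩

section Series

variable {a a₁ a₂ : ℕ → ℝ}

theorem isExpWeight_count (ha : ∀ n, 0 < a n)
    (hs : ∀ x : ℝ, 0 < x → Summable fun n => a n * x ^ n) :
    IsExpWeight (Measure.count : Measure ℕ) (fun n => (n : ℝ)) Set.univ a where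
  measurable := measurable_from_top
  pos := Eventually.of_forall ha
  integrable s _ := by
    rw [integrable_count_iff]
    refine (hs (Real.exp s) (Real.exp_pos s)).congr fun n => ?_
    rw [Real.norm_of_nonneg (mul_pos (Real.exp_pos _) (ha n)).le, mul_comm s, Real.exp_nat_mul,
      mul_comm]

/-- A power series with positive coefficients is an exponential integral for counting measure, since
xⁿ = exp(n log x). -/
theorem expInt_count_log (ha : ∀ n, 0 < a n)
    (hs : ∀ x : ℝ, 0 < x → Summable fun n => a n * x ^ n) {x : ℝ} (hx : 0 < x) :
    expInt (Measure.count : Measure ℕ) (fun n => (n : ℝ)) a (Real.log x) =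
      ∑' n : ℕ, a n * x ^ n := by
  unfold expInt
  rw [integral_countable ((isExpWeight_count ha hs).integrable _ trivial)]
  refine tsum_congr fun n => ?_
  rw [mul_comm (Real.log x), Real.exp_nat_mul, Real.exp_log hx]
  simp [Measure.real, mul_comm]

theorem count_separated (h₁ : ∀ n, 0 < a₁ n) (hr : StrictMono fun n => a₂ n / a₁ n) (c : ℝ)
    (hc : 0 < c) : ∃ γ : ℝ, ∀ᵐ n : ℕ ∂(Measure.count : Measure ℕ),
      ((n : ℝ) ≤ c → a₂ n ≤ γ * a₁ n) ∧ (c < (n : ℝ) → γ * a₁ n < a₂ n) := by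
  -- For a natural number n, n ≤ c means n ≤ ⌊c⌋, so the quotient at ⌊c⌋ separates.
  refine ⟨a₂ ⌊c⌋₊ / a₁ ⌊c⌋₊, Eventually.of_forall fun n => ⟨fun h => ?_, fun h => ?_⟩⟩
  · rw [← div_le_iff₀ (h₁ n)]
    exact hr.monotone (Nat.le_floor h)
  · rw [← lt_div_iff₀ (h₁ n)]
    exact hr ((Nat.floor_lt hc.le).2 h)

theorem count_dominated (h₂ : ∀ n, 0 < a₂ n)
    (hr : Tendsto (fun n => a₁ n / a₂ n) atTop (𝓝 0)) (δ : ℝ) (hδ : 0 < δ) :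
    ∃ K : ℝ, ∀ᵐ n : ℕ ∂(Measure.count : Measure ℕ), K < (n : ℝ) → a₁ n ≤ δ * a₂ n := by
  obtain ⟨N, hN⟩ := eventually_atTop.1 (hr.eventually (gt_mem_nhds hδ))
  refine ⟨N, Eventually.of_forall fun n hn => ?_⟩
  rw [← div_le_iff₀ (h₂ n)]
  exact (hN n (by exact_mod_cast hn.le)).le

end Series

/-- Diffusions on the positive half-line whose increasing solutions are power series and whose
decreasing solutions are Laplace transforms. -/
theorem Diffusion.hasRegularSolutions_of_halfLine {X : Diffusion} (hI : X.interval = Set.Ioi 0)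
    {a : ℝ → ℕ → ℝ} {C D p : ℝ → ℝ} {B h : ℝ → ℝ} {k : ℝ} (hk : 0 < k)
    (hP : IsExpRepr X.interval (X.phi .plus) (Measure.count : Measure ℕ) (fun n => (n : ℝ)) Set.univ
      a C Real.log (fun x => x⁻¹))
    (hM : IsExpRepr X.interval (X.phi .minus) (volume.restrict (Set.Ioi (0 : ℝ))) id (Set.Iio 0)
      (fun ρ => expFamily B h (p ρ)) D (fun x => -(k * x)) (fun _ => -k))
    (ha : ∀ ρ₁ ρ₂, 0 < ρ₁ → ρ₁ < ρ₂ → Tendsto (fun n => a ρ₁ n / a ρ₂ n) atTop (𝓝 0))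
    (hapos : ∀ ρ, 0 < ρ → ∀ n, 0 < a ρ n)
    (hp : ∀ ρ, 0 < ρ → 0 < p ρ) (hpmono : ∀ ρ₁ ρ₂, ρ₁ < ρ₂ → p ρ₁ < p ρ₂)
    (hB : ∀ t, 0 < t → 0 < B t) (hh : StrictAntiOn h (Set.Ioi 0))
    (hh0 : Tendsto h atTop (𝓝 0)) (hhpos : ∀ t, 0 < t → 0 < h t)
    {c : ℝ} (hc : 0 < c) (hhlow : ∀ t, 1 ≤ t → c / t ≤ h t)
    (hBlow : ∀ t, 1 ≤ t → 1 / t ≤ B t) (hBlow' : X.IsOUOrOneLeMu → ∀ t, 1 ≤ t → 1 ≤ B t) :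
    X.HasRegularSolutions (𝓝[>] 0) := by
  have hpos : ∀ᶠ x in 𝓝[>] (0 : ℝ), x ∈ X.interval := by
    rw [hI]; exact self_mem_nhdsWithin
  have htop : ∀ᶠ x in (atTop : Filter ℝ), x ∈ X.interval := by
    rw [hI]; exact eventually_gt_atTop 0
  have hu0 : Tendsto (fun x : ℝ => -(k * x)) (𝓝[>] 0) (𝓝[<] 0) := by
    refine tendsto_nhdsWithin_iff.2 ⟨?_, ?_⟩
    · have : Tendsto (fun x : ℝ => -(k * x)) (𝓝 0) (𝓝 (-(k * 0))) :=
        Continuous.tendsto (by fun_prop) 0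
      simp only [mul_zero, neg_zero] at this
      exact this.mono_left nhdsWithin_le_nhds
    · filter_upwards [self_mem_nhdsWithin] with x (hx : 0 < x)
      exact neg_neg_of_pos (mul_pos hk hx)
  refine hasRegularSolutions_of_isExpRepr hP hM ?_ ?_ inferInstance ?_ ?_ ?_ ?_ ?_
  · intro x hx
    rw [hI] at hx
    exact inv_pos.2 hx
  · intro x _
    exact neg_neg_of_pos hk
  · intro x hx
    rw [hI] at hx ⊢
    filter_upwards [Ioo_mem_nhdsGT hx] with y hy
    exact hy
  · intro ρ hρ
    exact hM.tendsto_atTop hρ hpos hu0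
      (expFamily_tendsto_atTop (hM.weight ρ hρ) (hp ρ hρ) hh one_pos hBlow)
  · intro ρ hρ
    refine hM.tendsto_zero hρ htop (tendsto_neg_atTop_atBot.comp (tendsto_id.const_mul_atTop hk))
      ((hM.weight ρ hρ).tendsto_expInt_atBot measurable_id ?_ (s₀ := -1) (by simp))
    exact ae_restrict_mem measurableSet_Ioi
  · intro ρ₁ ρ₂ hρ₁ hlt
    have hρ₂ := hρ₁.trans hlt
    have := hP.tendsto_div hρ₁ hρ₂ htop Real.tendsto_log_atTop
      (tendsto_expInt_div_zero_atTop (hP.weight ρ₁ hρ₁) (hP.weight ρ₂ hρ₂)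
        isUnboundedNonneg_natCast (count_dominated (hapos ρ₂ hρ₂) (ha ρ₁ ρ₂ hρ₁ hlt)))
    rwa [mul_zero] at this
  · intro hX ρ₁ ρ₂ hρ₁ hlt
    have hρ₂ := hρ₁.trans hlt
    obtain ⟨h1, h2⟩ := expFamily_ratio hB (hM.weight ρ₁ hρ₁) (hM.weight ρ₂ hρ₂) (hp ρ₁ hρ₁)
      (hpmono ρ₁ ρ₂ hlt) hh hh0 hhpos hc hhlow one_pos (hBlow' hX)
    -- The exponential integrals are asymptotically equal, so the limit r is the quotient of the
    -- constants D.
    have h3 := hM.tendsto_div hρ₁ hρ₂ hpos hu0 h1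
    rw [mul_one] at h3
    exact ⟨_, h3, hM.tendsto_sub_atTop hρ₁ hρ₂ hpos hu0 h2⟩

/-! ### The Ornstein–Uhlenbeck diffusion -/

/-- Writing t^υ as exp(−υh) with the decreasing function h = −log t puts the cylinder weight in the
common form. -/
theorem expFamily_cylinder_eq {υ t : ℝ} (ht : 0 < t) :
    expFamily (fun t => Real.exp (-t ^ 2 / 2) / t) (fun t => -Real.log t) υ t =
      t ^ (υ - 1) * Real.exp (-t ^ 2 / 2) := by
  unfold expFamily
  have e : -(υ * -Real.log t) = Real.log t * υ := by ring
  rw [Real.rpow_sub_one ht.ne', Real.rpow_def_of_pos ht, e]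
  ring

theorem isExpWeight_cylinder {υ : ℝ} (hυ : 0 < υ) :
    IsExpWeight (volume.restrict (Set.Ioi (0 : ℝ))) id Set.univ
      (expFamily (fun t => Real.exp (-t ^ 2 / 2) / t) (fun t => -Real.log t) υ) := by
  refine isExpWeight_expFamily (by fun_prop) (by fun_prop) (fun t ht => by positivity) ?_
  intro s _
  -- The majorant comes from st − t²/2 ≤ s² − t²/4, that is, (s − t/2)² ≥ 0.
  have hg := (integrableOn_rpow_mul_exp_neg_mul_sq (b := 1 / 4) (by norm_num)
    (s := υ - 1) (by linarith)).const_mul (Real.exp (s ^ 2))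
  refine Integrable.mono' hg ?_ ?_
  · refine Measurable.aestronglyMeasurable ?_
    unfold expFamily
    fun_prop
  · filter_upwards [ae_restrict_mem measurableSet_Ioi] with t (ht : 0 < t)
    rw [expFamily_cylinder_eq ht, Real.norm_of_nonneg (by positivity), mul_left_comm,
      mul_left_comm (Real.exp (s ^ 2)), ← Real.exp_add, ← Real.exp_add]
    refine mul_le_mul_of_nonneg_left (Real.exp_le_exp.2 ?_) (by positivity)
    nlinarith [sq_nonneg (s - t / 2)]

theorem exp_mul_parabolicCylinderDNeg (υ z : ℝ) :
    Real.exp (z ^ 2 / 4) * parabolicCylinderDNeg υ z = (Real.Gamma υ)⁻¹ *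
      expInt (volume.restrict (Set.Ioi (0 : ℝ))) id
        (expFamily (fun t => Real.exp (-t ^ 2 / 2) / t) (fun t => -Real.log t) υ) (-z) := by
  unfold parabolicCylinderDNeg expInt
  rw [← mul_assoc, ← mul_assoc, ← Real.exp_add, neg_div, add_neg_cancel, Real.exp_zero, one_mul]
  congr 1
  refine setIntegral_congr_fun measurableSet_Ioi fun t ht => ?_
  simp only [id]
  rw [expFamily_cylinder_eq ht, mul_left_comm, ← Real.exp_add]
  ring_nf

theorem ou_hasRegularSolutions (lam0 lam1 nu0 : ℝ) (hlam1 : 0 < lam1) (hnu : 0 < nu0) :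
    (Diffusion.ou lam0 lam1 nu0 hlam1 hnu).HasRegularSolutions atBot := by
  set X := Diffusion.ou lam0 lam1 nu0 hlam1 hnu with hX
  set k := Real.sqrt (2 * lam1 / nu0 ^ 2) with hk
  have hκ : 0 < 2 * lam1 / nu0 ^ 2 := by positivity
  have hkpos : 0 < k := Real.sqrt_pos.2 hκ
  have hk2 : ∀ y : ℝ, 2 * lam1 / nu0 ^ 2 * y ^ 2 / 4 = (k * y) ^ 2 / 4 := by
    intro y; rw [mul_pow, hk, Real.sq_sqrt hκ.le]
  set B : ℝ → ℝ := fun t => Real.exp (-t ^ 2 / 2) / t with hBdef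
  set h : ℝ → ℝ := fun t => -Real.log t with hhdef
  set w : ℝ → ℝ → ℝ := fun ρ => expFamily B h (ρ / lam1) with hw
  set C : ℝ → ℝ := fun ρ => (Real.Gamma (ρ / lam1))⁻¹ with hC
  have hB : ∀ t, 0 < t → 0 < B t := fun t ht => by simp only [hBdef]; positivity
  have hweight : ∀ ρ, 0 < ρ → IsExpWeight (volume.restrict (Set.Ioi (0 : ℝ))) id Set.univ (w ρ) :=
    fun ρ hρ => isExpWeight_cylinder (div_pos hρ hlam1)
  have hCpos : ∀ ρ, 0 < ρ → 0 < C ρ := fun ρ hρ =>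
    inv_pos.2 (Real.Gamma_pos_of_pos (div_pos hρ hlam1))
  have hanti : StrictAntiOn h (Set.Ioi 0) := fun x hx y _ hxy =>
    neg_lt_neg (Real.log_lt_log hx hxy)
  have hsep : ∀ ρ₁ ρ₂ : ℝ, 0 < ρ₁ → ρ₁ < ρ₂ → ∀ a : ℝ, 0 < a → ∃ γ : ℝ,
      ∀ᵐ t ∂(volume.restrict (Set.Ioi (0 : ℝ))),
      (id t ≤ a → w ρ₂ t ≤ γ * w ρ₁ t) ∧ (a < id t → γ * w ρ₁ t < w ρ₂ t) := fun ρ₁ ρ₂ _ hlt =>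
    expFamily_separated hB hanti (div_lt_div_of_pos_right hlt hlam1)
  have hP : IsExpRepr X.interval (X.phi .plus) (volume.restrict (Set.Ioi (0 : ℝ))) id Set.univ w C
      (fun x => k * (x - lam0 / lam1)) (fun _ => k) :=
    { isOpen := X.isOpen_interval
      isOpen_param := isOpen_univ
      unbounded := isUnboundedNonneg_id
      weight := hweight
      const_pos := hCpos
      hasDerivAt := fun x _ => by
        simpa using ((hasDerivAt_id x).sub_const (lam0 / lam1)).const_mul k
      mem := fun _ _ => trivial
      eq := fun ρ _ x _ => by
        have := exp_mul_parabolicCylinderDNeg (ρ / lam1) (-(k * (x - lam0 / lam1)))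
        rw [neg_sq, ← hk2, neg_neg] at this
        exact this
      separated := hsep }
  have hM : IsExpRepr X.interval (X.phi .minus) (volume.restrict (Set.Ioi (0 : ℝ))) id Set.univ w C
      (fun x => -(k * (x - lam0 / lam1))) (fun _ => -k) :=
    { isOpen := X.isOpen_interval
      isOpen_param := isOpen_univ
      unbounded := isUnboundedNonneg_id
      weight := hweight
      const_pos := hCpos
      hasDerivAt := fun x _ => by
        simpa using (((hasDerivAt_id x).sub_const (lam0 / lam1)).const_mul k).fun_neg
      mem := fun _ _ => trivial
      eq := fun ρ _ x _ => by
        have := exp_mul_parabolicCylinderDNeg (ρ / lam1) (k * (x - lam0 / lam1))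
        rw [← hk2] at this
        exact this
      separated := hsep }
  have hutop : Tendsto (fun x => k * (x - lam0 / lam1)) atTop atTop :=
    (tendsto_atTop_add_const_right _ (-(lam0 / lam1)) tendsto_id).const_mul_atTop hkpos
  have hubot : Tendsto (fun x => k * (x - lam0 / lam1)) atBot atBot :=
    (tendsto_atBot_add_const_right _ (-(lam0 / lam1)) tendsto_id).const_mul_atBot hkpos
  have hall : ∀ l : Filter ℝ, ∀ᶠ x in l, x ∈ X.interval := fun l => Eventually.of_forall fun _ => trivial
  have hratio : ∀ ρ₁ ρ₂ : ℝ, 0 < ρ₁ → ρ₁ < ρ₂ → Tendsto (fun s =>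
      expInt (volume.restrict (Set.Ioi (0 : ℝ))) id (w ρ₁) s /
        expInt (volume.restrict (Set.Ioi (0 : ℝ))) id (w ρ₂) s) atTop (𝓝 0) := by
    intro ρ₁ ρ₂ hρ₁ hlt
    refine tendsto_expInt_div_zero_atTop (hweight ρ₁ hρ₁) (hweight ρ₂ (hρ₁.trans hlt))
      isUnboundedNonneg_id ?_
    intro δ hδ
    have hd : 0 < ρ₂ / lam1 - ρ₁ / lam1 := sub_pos.2 (div_lt_div_of_pos_right hlt hlam1)
    have hlim : Tendsto (fun t => Real.exp ((ρ₂ / lam1 - ρ₁ / lam1) * h t)) atTop (𝓝 0) :=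
      Real.tendsto_exp_atBot.comp
        ((tendsto_neg_atTop_atBot.comp Real.tendsto_log_atTop).const_mul_atBot hd)
    obtain ⟨K, hK⟩ := eventually_atTop.1 (hlim.eventually (gt_mem_nhds hδ))
    refine ⟨K, ?_⟩
    filter_upwards [ae_restrict_mem measurableSet_Ioi] with t ht htK
    simp only [hw]
    rw [expFamily_eq_mul (p₁ := ρ₁ / lam1) (p₂ := ρ₂ / lam1) t]
    exact mul_le_mul_of_nonneg_right (hK t (le_of_lt htK)).le (expFamily_pos hB ht).le
  have hleft : ∀ ρ, 0 < ρ → Tendsto (X.phi .minus ρ) atBot atTop := fun ρ hρ =>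
    hM.tendsto_atTop hρ (hall _) (tendsto_neg_atBot_atTop.comp hubot)
      ((hweight ρ hρ).tendsto_expInt_atTop isUnboundedNonneg_id)
  refine Diffusion.hasRegularSolutions_of_isExpRepr hP hM (fun _ _ => hkpos)
    (fun _ _ => neg_neg_of_pos hkpos) inferInstance ?_ hleft ?_ ?_ ?_
  · intro x _
    filter_upwards [eventually_lt_atBot x] with y hy
    exact ⟨trivial, hy⟩
  · intro ρ hρ
    exact hM.tendsto_zero hρ (hall _) (tendsto_neg_atTop_atBot.comp hutop)
      ((hweight ρ hρ).tendsto_expInt_atBot measurable_id (ae_restrict_mem measurableSet_Ioi)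
        (s₀ := 0) trivial)
  · intro ρ₁ ρ₂ hρ₁ hlt
    have := hP.tendsto_div hρ₁ (hρ₁.trans hlt) (hall _) hutop (hratio ρ₁ ρ₂ hρ₁ hlt)
    rwa [mul_zero] at this
  · intro _ ρ₁ ρ₂ hρ₁ hlt
    -- As x → −∞ the argument of φ⁻ tends to +∞, where the weight with larger ρ dominates. Hence r =
    -- 0, and the difference is φ⁻ itself.
    refine ⟨0, ?_, ?_⟩
    · have := hM.tendsto_div hρ₁ (hρ₁.trans hlt) (hall _) (tendsto_neg_atBot_atTop.comp hubot)
        (hratio ρ₁ ρ₂ hρ₁ hlt)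
      rwa [mul_zero] at this
    · simpa using hleft ρ₁ hρ₁

/-! ### The squared Bessel diffusion -/

section Bessel

variable {μ θ : ℝ}

theorem gamma_le_gamma_natCast_add (hμ : 0 < μ) (n : ℕ) :
    Real.Gamma (μ + 1) ≤ Real.Gamma (n + μ + 1) := by
  induction n with
  | zero => simp
  | succ n ih =>
    have hn : (0 : ℝ) ≤ n := n.cast_nonneg
    have hp : 0 < Real.Gamma (n + μ + 1) := Real.Gamma_pos_of_pos (by linarith)
    have e : ((n + 1 : ℕ) : ℝ) + μ + 1 = (n + μ + 1) + 1 := by push_cast; ring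
    rw [e, Real.Gamma_add_one (s := n + μ + 1) (by linarith)]
    nlinarith

/-- Coefficients of the power series of the modified Bessel function. -/
noncomputable def besselCoeff (μ θ : ℝ) (n : ℕ) : ℝ :=
  θ ^ n / ((n.factorial : ℝ) * Real.Gamma ((n : ℝ) + μ + 1))

theorem besselCoeff_pos (hμ : 0 < μ) (hθ : 0 < θ) (n : ℕ) : 0 < besselCoeff μ θ n := by
  have : 0 < Real.Gamma ((n : ℝ) + μ + 1) := Real.Gamma_pos_of_pos (by positivity)
  unfold besselCoeff
  positivity

theorem summable_besselCoeff (hμ : 0 < μ) (hθ : 0 < θ) (x : ℝ) (hx : 0 < x) :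
    Summable fun n => besselCoeff μ θ n * x ^ n := by
  have hp : 0 < Real.Gamma (μ + 1) := Real.Gamma_pos_of_pos (by linarith)
  refine Summable.of_nonneg_of_le (fun n => (mul_pos (besselCoeff_pos hμ hθ n) (by positivity)).le)
    (fun n => ?_) ((Real.summable_pow_div_factorial (θ * x)).mul_left (Real.Gamma (μ + 1))⁻¹)
  have := gamma_le_gamma_natCast_add hμ n
  calc besselCoeff μ θ n * x ^ n
      = (θ * x) ^ n / n.factorial * (Real.Gamma ((n : ℝ) + μ + 1))⁻¹ := by
        unfold besselCoeff; rw [mul_pow]; field_simp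
    _ ≤ (θ * x) ^ n / n.factorial * (Real.Gamma (μ + 1))⁻¹ := by gcongr
    _ = _ := mul_comm _ _

theorem besselCoeff_div (hμ : 0 < μ) {θ' : ℝ} (n : ℕ) :
    besselCoeff μ θ n / besselCoeff μ θ' n = (θ / θ') ^ n := by
  have : 0 < Real.Gamma ((n : ℝ) + μ + 1) := Real.Gamma_pos_of_pos (by positivity)
  have : (n.factorial : ℝ) ≠ 0 := by positivity
  unfold besselCoeff
  rw [div_div_div_cancel_right₀ (by positivity), div_pow]

/-- The prefactor cancels the power x^(μ/2) and leaves a genuine power series in x. -/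
theorem rpow_mul_besselI (hθ : 0 < θ) {x : ℝ} (hx : 0 < x) :
    x ^ (-μ / 2) * besselI μ (2 * Real.sqrt (θ * x)) =
      θ ^ (μ / 2) * ∑' n : ℕ, besselCoeff μ θ n * x ^ n := by
  unfold besselI
  rw [← tsum_mul_left, ← tsum_mul_left]
  refine tsum_congr fun n => ?_
  have h1 : (2 * Real.sqrt (θ * x) / 2) ^ (2 * (n : ℝ) + μ) =
      θ ^ n * x ^ n * (θ ^ (μ / 2) * x ^ (μ / 2)) := by
    rw [mul_div_cancel_left₀ _ (two_ne_zero), Real.sqrt_eq_rpow, ← Real.rpow_mul (by positivity)]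
    have : 1 / 2 * (2 * (n : ℝ) + μ) = n + μ / 2 := by ring
    rw [this, Real.rpow_add (by positivity), Real.rpow_natCast, mul_pow,
      Real.mul_rpow hθ.le hx.le]
  have h2 : x ^ (-μ / 2) * x ^ (μ / 2) = 1 := by
    rw [← Real.rpow_add hx, neg_div, neg_add_cancel, Real.rpow_zero]
  rw [h1]
  unfold besselCoeff
  calc _ = (x ^ (-μ / 2) * x ^ (μ / 2)) * (θ ^ (μ / 2) * (θ ^ n * x ^ n /
        ((n.factorial : ℝ) * Real.Gamma ((n : ℝ) + μ + 1)))) := by ring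
    _ = _ := by rw [h2]; ring

theorem isExpWeight_bessel (hμ : 0 < μ) (hθ : 0 < θ) :
    IsExpWeight (volume.restrict (Set.Ioi (0 : ℝ))) id (Set.Iio 0)
      (expFamily (fun t => t ^ (μ - 1)) (fun t => t⁻¹) θ) := by
  refine isExpWeight_expFamily (by fun_prop) (by fun_prop) (fun t ht => by positivity) ?_
  intro s (hs : s < 0)
  have hg := integrableOn_rpow_mul_exp_neg_mul_rpow (p := 1) (b := -s) (s := μ - 1) (by linarith)
    one_pos (by linarith)
  refine Integrable.mono' hg ?_ ?_
  · refine Measurable.aestronglyMeasurable ?_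
    unfold expFamily
    fun_prop
  · filter_upwards [ae_restrict_mem measurableSet_Ioi] with t (ht : 0 < t)
    unfold expFamily
    rw [Real.norm_of_nonneg (by positivity), Real.rpow_one, neg_neg, mul_left_comm]
    refine mul_le_mul_of_nonneg_left ?_ (by positivity)
    refine mul_le_of_le_one_right (Real.exp_pos _).le (Real.exp_le_one_iff.2 ?_)
    rw [neg_nonpos]
    positivity

/-- The Macdonald function as a Laplace transform. -/
theorem expInt_bessel_eq (hμ : 0 < μ) (hθ : 0 < θ) {x : ℝ} (hx : 0 < x) :
    expInt (volume.restrict (Set.Ioi (0 : ℝ))) id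
      (expFamily (fun t => t ^ (μ - 1)) (fun t => t⁻¹) θ) (-x) =
      2 * (Real.sqrt θ / Real.sqrt x) ^ μ * besselK μ (2 * Real.sqrt (θ * x)) := by
  -- Under t = c exp(v) this c balances the exponents: xt and θ/t become (z/2)exp(v) and
  -- (z/2)exp(−v), with sum z cosh v.
  set c := Real.sqrt θ / Real.sqrt x with hc
  have hsx : 0 < Real.sqrt x := Real.sqrt_pos.2 hx
  have hsθ : 0 < Real.sqrt θ := Real.sqrt_pos.2 hθ
  have hcpos : 0 < c := div_pos hsθ hsx
  set z := 2 * Real.sqrt (θ * x) with hz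
  have hxc : x * c = z / 2 := by
    rw [hc, hz, Real.sqrt_mul hθ.le]
    nth_rw 1 [← Real.mul_self_sqrt hx.le]
    field_simp
  have hθc : θ * c⁻¹ = z / 2 := by
    rw [hc, hz, Real.sqrt_mul hθ.le, inv_div]
    nth_rw 1 [← Real.mul_self_sqrt hθ.le]
    field_simp
  set g : ℝ → ℝ := fun t => Real.exp (-x * t) * expFamily (fun t => t ^ (μ - 1)) (fun t => t⁻¹) θ t
    with hg
  have hgi : IntegrableOn g (Set.Ioi 0) := (isExpWeight_bessel hμ hθ).integrable (-x) (by simpa)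
  set f : ℝ → ℝ := fun v => c * Real.exp v with hf
  have himg : f '' Set.univ = Set.Ioi 0 := by
    ext t
    simp only [Set.image_univ, Set.mem_range, Set.mem_Ioi, hf]
    constructor
    · rintro ⟨v, rfl⟩; positivity
    · intro ht
      exact ⟨Real.log (t / c), by rw [Real.exp_log (by positivity)]; field_simp⟩
  have hder : ∀ v ∈ Set.univ, HasDerivWithinAt f (c * Real.exp v) Set.univ v := fun v _ =>
    ((Real.hasDerivAt_exp v).const_mul c).hasDerivWithinAt
  have hinj : Set.InjOn f Set.univ := fun v _ v' _ h =>
    Real.exp_injective (mul_left_cancel₀ hcpos.ne' h)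
  set G : ℝ → ℝ := fun v => c ^ μ * (Real.exp (-z * Real.cosh v) * Real.exp (μ * v)) with hG
  have hfg : ∀ v, |c * Real.exp v| • g (f v) = G v := by
    intro v
    have hev := Real.exp_pos v
    simp only [hg, hf, hG, expFamily, smul_eq_mul]
    rw [abs_of_pos (by positivity), Real.rpow_sub_one (by positivity),
      Real.mul_rpow hcpos.le hev.le, ← Real.exp_mul, mul_inv, ← mul_assoc θ, hθc, neg_mul,
      ← mul_assoc x, hxc, ← Real.exp_neg v]
    have e : Real.exp (-z * Real.cosh v) =
        Real.exp (-(z / 2 * Real.exp v)) * Real.exp (-(z / 2 * Real.exp (-v))) := by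
      rw [← Real.exp_add, Real.cosh_eq]; ring_nf
    rw [e, mul_comm μ v]
    field_simp
  have hGi : Integrable G := by
    have := (integrableOn_image_iff_integrableOn_abs_deriv_smul MeasurableSet.univ hder hinj g).1
      (himg ▸ hgi)
    rw [integrableOn_univ] at this
    exact this.congr (Eventually.of_forall hfg)
  have h1 : expInt (volume.restrict (Set.Ioi (0 : ℝ))) id
      (expFamily (fun t => t ^ (μ - 1)) (fun t => t⁻¹) θ) (-x) = ∫ v, G v := by
    have := integral_image_eq_integral_abs_deriv_smul MeasurableSet.univ hder hinj g
    rw [himg, setIntegral_univ] at this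
    refine this.trans ?_
    simp only [hfg]
  have h2 : ∫ v, G (-v) = ∫ v, G v := integral_neg_eq_self G volume
  -- Averaging over v and −v turns exp(μv) into cosh(μv); evenness then reduces the integral to
  -- twice that over the half-line.
  have h3 : ∫ v, G v = ∫ v, (G v + G (-v)) / 2 := by
    rw [integral_div, integral_add hGi hGi.comp_neg, h2]; ring
  have h4 : ∀ v, (G v + G (-v)) / 2 =
      (fun v => c ^ μ * (Real.exp (-z * Real.cosh v) * Real.cosh (μ * v))) |v| := by
    intro v
    simp only [hG]
    have e : Real.cosh (μ * |v|) = Real.cosh (μ * v) := by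
      rw [← Real.cosh_abs, abs_mul, abs_abs, ← abs_mul, Real.cosh_abs]
    rw [Real.cosh_abs, e, Real.cosh_neg, Real.cosh_eq (μ * v), mul_neg]
    ring
  rw [h1, h3, integral_congr_ae (Eventually.of_forall h4),
    integral_comp_abs (f := fun v => c ^ μ * (Real.exp (-z * Real.cosh v) * Real.cosh (μ * v))),
    integral_const_mul]
  unfold besselK
  ring

theorem rpow_mul_besselK (hμ : 0 < μ) (hθ : 0 < θ) {x : ℝ} (hx : 0 < x) :
    x ^ (-μ / 2) * besselK μ (2 * Real.sqrt (θ * x)) =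
      θ ^ (-μ / 2) / 2 * expInt (volume.restrict (Set.Ioi (0 : ℝ))) id
        (expFamily (fun t => t ^ (μ - 1)) (fun t => t⁻¹) θ) (-x) := by
  have e : ∀ y : ℝ, 0 < y → Real.sqrt y ^ μ = y ^ (μ / 2) := fun y hy => by
    rw [Real.sqrt_eq_rpow, ← Real.rpow_mul hy.le]; ring_nf
  rw [expInt_bessel_eq hμ hθ hx, Real.div_rpow (Real.sqrt_nonneg _) (Real.sqrt_nonneg _),
    e θ hθ, e x hx, neg_div, Real.rpow_neg hx.le, Real.rpow_neg hθ.le]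
  have := Real.rpow_pos_of_pos hx (μ / 2)
  have := Real.rpow_pos_of_pos hθ (μ / 2)
  field_simp

end Bessel

theorem sqb_hasRegularSolutions (lam0 nu0 : ℝ) (hnu : 0 < nu0)
    (hmu : 0 < 2 * lam0 / nu0 ^ 2 - 1) :
    (Diffusion.sqb lam0 nu0 hnu hmu).HasRegularSolutions (𝓝[>] 0) := by
  set X := Diffusion.sqb lam0 nu0 hnu hmu with hX
  set μ := 2 * lam0 / nu0 ^ 2 - 1 with hμ
  set p : ℝ → ℝ := fun ρ => 2 * ρ / nu0 ^ 2 with hp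
  have hppos : ∀ ρ, 0 < ρ → 0 < p ρ := fun ρ hρ => by simp only [hp]; positivity
  have hpmono : ∀ ρ₁ ρ₂, ρ₁ < ρ₂ → p ρ₁ < p ρ₂ := fun ρ₁ ρ₂ hlt => by
    simp only [hp]; gcongr
  have harg : ∀ ρ x : ℝ, 2 * Real.sqrt (2 * ρ * x) / nu0 = 2 * Real.sqrt (p ρ * x) := by
    intro ρ x
    have : p ρ * x = 2 * ρ * x / nu0 ^ 2 := by simp only [hp]; ring
    rw [this, Real.sqrt_div' _ (by positivity), Real.sqrt_sq hnu.le, mul_div_assoc]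
  have hanti : StrictAntiOn (fun t : ℝ => t⁻¹) (Set.Ioi 0) := fun x hx y _ hxy =>
    inv_strictAnti₀ hx hxy
  have hB : ∀ t : ℝ, 0 < t → 0 < t ^ (μ - 1) := fun t ht => Real.rpow_pos_of_pos ht _
  have hP : IsExpRepr X.interval (X.phi .plus) (Measure.count : Measure ℕ) (fun n => (n : ℝ))
      Set.univ (fun ρ => besselCoeff μ (p ρ)) (fun ρ => p ρ ^ (μ / 2)) Real.log (fun x => x⁻¹) :=
    { isOpen := X.isOpen_interval
      isOpen_param := isOpen_univ
      unbounded := isUnboundedNonneg_natCast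
      weight := fun ρ hρ => isExpWeight_count (besselCoeff_pos hmu (hppos ρ hρ))
        (summable_besselCoeff hmu (hppos ρ hρ))
      const_pos := fun ρ hρ => Real.rpow_pos_of_pos (hppos ρ hρ) _
      hasDerivAt := fun x (hx : 0 < x) => Real.hasDerivAt_log hx.ne'
      mem := fun _ _ => trivial
      eq := fun ρ hρ x (hx : 0 < x) => by
        rw [expInt_count_log (besselCoeff_pos hmu (hppos ρ hρ))
          (summable_besselCoeff hmu (hppos ρ hρ)) hx, ← rpow_mul_besselI (hppos ρ hρ) hx, ← harg]
        rfl
      separated := fun ρ₁ ρ₂ hρ₁ hlt => by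
        refine count_separated (besselCoeff_pos hmu (hppos ρ₁ hρ₁)) ?_
        simp only [besselCoeff_div hmu]
        exact pow_right_strictMono₀ ((one_lt_div (hppos ρ₁ hρ₁)).2 (hpmono ρ₁ ρ₂ hlt)) }
  have hM : IsExpRepr X.interval (X.phi .minus) (volume.restrict (Set.Ioi (0 : ℝ))) id (Set.Iio 0)
      (fun ρ => expFamily (fun t => t ^ (μ - 1)) (fun t => t⁻¹) (p ρ))
      (fun ρ => p ρ ^ (-μ / 2) / 2) (fun x => -(1 * x)) (fun _ => -1) :=
    { isOpen := X.isOpen_interval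
      isOpen_param := isOpen_Iio
      unbounded := isUnboundedNonneg_id
      weight := fun ρ hρ => isExpWeight_bessel hmu (hppos ρ hρ)
      const_pos := fun ρ hρ => half_pos (Real.rpow_pos_of_pos (hppos ρ hρ) _)
      hasDerivAt := fun x _ => by simpa using (hasDerivAt_id x).fun_neg
      mem := fun x (hx : 0 < x) => by simpa using hx
      eq := fun ρ hρ x (hx : 0 < x) => by
        rw [one_mul, ← rpow_mul_besselK hmu (hppos ρ hρ) hx, ← harg]
        rfl
      separated := fun ρ₁ ρ₂ _ hlt => expFamily_separated hB hanti (hpmono ρ₁ ρ₂ hlt) }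
  refine Diffusion.hasRegularSolutions_of_halfLine (X := X) rfl one_pos hP hM ?_
    (fun ρ hρ => besselCoeff_pos hmu (hppos ρ hρ)) hppos hpmono hB hanti tendsto_inv_atTop_zero
    (fun t ht => inv_pos.2 ht) one_pos (fun t _ => (one_div t).le) ?_ ?_
  · intro ρ₁ ρ₂ hρ₁ hlt
    simp only [besselCoeff_div hmu]
    exact tendsto_pow_atTop_nhds_zero_of_lt_one
      (div_pos (hppos ρ₁ hρ₁) (hppos ρ₂ (hρ₁.trans hlt))).le
      ((div_lt_one (hppos ρ₂ (hρ₁.trans hlt))).2 (hpmono ρ₁ ρ₂ hlt))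
  · intro t ht
    rw [one_div, ← Real.rpow_neg_one]
    exact Real.rpow_le_rpow_of_exponent_le ht (by linarith)
  -- The condition μ ≥ 1 keeps t^(μ−1) bounded below at infinity.
  · intro (h1 : 1 ≤ μ) t ht
    exact Real.one_le_rpow ht (by linarith)

/-! ### The Cox–Ingersoll–Ross diffusion -/

section Kummer

variable {α α₁ α₂ β κ μ : ℝ}

theorem ascPochhammer_eval_eq_prod (n : ℕ) (s : ℝ) :
    (ascPochhammer ℝ n).eval s = ∏ j ∈ Finset.range n, (s + j) := by
  induction n with
  | zero => simp
  | succ n ih => rw [ascPochhammer_succ_eval, ih, Finset.prod_range_succ]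

/-- By Gauss's product for Γ the quotient is asymptotic to a constant times n^(α₁ − α₂). -/
theorem tendsto_ascPochhammer_div (hα₁ : 0 < α₁) (hlt : α₁ < α₂) :
    Tendsto (fun n => (ascPochhammer ℝ n).eval α₁ / (ascPochhammer ℝ n).eval α₂) atTop (𝓝 0) := by
  have hα₂ := hα₁.trans hlt
  -- The n-th term of Gauss's sequence contains n + 1 factors, hence the shift.
  rw [← tendsto_add_atTop_iff_nat 1]
  have h1 : Tendsto (fun n : ℕ => ((n : ℝ) ^ (-(α₂ - α₁)))) atTop (𝓝 0) :=
    (tendsto_rpow_neg_atTop (sub_pos.2 hlt)).comp tendsto_natCast_atTop_atTop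
  have h2 := ((Real.GammaSeq_tendsto_Gamma α₂).div (Real.GammaSeq_tendsto_Gamma α₁)
    (Real.Gamma_pos_of_pos hα₁).ne').mul h1
  rw [mul_zero] at h2
  refine h2.congr' ?_
  filter_upwards [eventually_gt_atTop 0] with n hn
  have hn' : (0 : ℝ) < n := by exact_mod_cast hn
  have p1 := ascPochhammer_pos (S := ℝ) (n + 1) α₁ hα₁
  have p2 := ascPochhammer_pos (S := ℝ) (n + 1) α₂ hα₂
  have hf : (n.factorial : ℝ) ≠ 0 := by positivity
  have q1 := Real.rpow_pos_of_pos hn' α₁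
  have q2 := Real.rpow_pos_of_pos hn' α₂
  simp only [Pi.div_apply, Real.GammaSeq]
  rw [← ascPochhammer_eval_eq_prod, ← ascPochhammer_eval_eq_prod, neg_sub,
    Real.rpow_sub hn']
  field_simp

/-- Coefficients of the power series of Kummer's function in the scaled variable. -/
noncomputable def kummerCoeff (α β κ : ℝ) (n : ℕ) : ℝ :=
  (ascPochhammer ℝ n).eval α / (ascPochhammer ℝ n).eval β * κ ^ n / (n.factorial : ℝ)

theorem kummerCoeff_pos (hα : 0 < α) (hβ : 0 < β) (hκ : 0 < κ) (n : ℕ) :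
    0 < kummerCoeff α β κ n := by
  have p1 := ascPochhammer_pos (S := ℝ) n α hα
  have p2 := ascPochhammer_pos (S := ℝ) n β hβ
  unfold kummerCoeff
  positivity

theorem ascPochhammer_div_le (hα : 0 < α) (hβ : 1 ≤ β) (n : ℕ) :
    (ascPochhammer ℝ n).eval α / (ascPochhammer ℝ n).eval β ≤ (1 + α) ^ n := by
  induction n with
  | zero => simp
  | succ n ih =>
    have hβ' : 0 < β := by linarith
    have p1 := ascPochhammer_pos (S := ℝ) n α hα
    have p2 := ascPochhammer_pos (S := ℝ) n β hβ'
    have hn : (0 : ℝ) ≤ n := n.cast_nonneg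
    rw [ascPochhammer_succ_eval, ascPochhammer_succ_eval, ← div_mul_div_comm, pow_succ]
    refine mul_le_mul ih ?_ (by positivity) (by positivity)
    rw [div_le_iff₀ (by positivity)]
    nlinarith [mul_nonneg hα.le hn, mul_nonneg hα.le (sub_nonneg.2 hβ)]

theorem summable_kummerCoeff (hα : 0 < α) (hβ : 1 ≤ β) (hκ : 0 < κ) (x : ℝ) (hx : 0 < x) :
    Summable fun n => kummerCoeff α β κ n * x ^ n := by
  refine Summable.of_nonneg_of_le
    (fun n => (mul_pos (kummerCoeff_pos hα (by linarith) hκ n) (by positivity)).le)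
    (fun n => ?_) (Real.summable_pow_div_factorial ((1 + α) * (κ * x)))
  calc kummerCoeff α β κ n * x ^ n
      = (ascPochhammer ℝ n).eval α / (ascPochhammer ℝ n).eval β * (κ * x) ^ n / n.factorial := by
        unfold kummerCoeff; rw [mul_pow]; ring
    _ ≤ (1 + α) ^ n * (κ * x) ^ n / n.factorial := by
        have := ascPochhammer_div_le hα hβ n
        gcongr
    _ = _ := by rw [← mul_pow]

theorem kummerM_eq_tsum (x : ℝ) :
    kummerM α β (κ * x) = ∑' n : ℕ, kummerCoeff α β κ n * x ^ n := by
  unfold kummerM kummerCoeff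
  refine tsum_congr fun n => ?_
  rw [mul_pow]; ring

theorem kummerCoeff_div (hβ : 0 < β) (hκ : 0 < κ) (n : ℕ) :
    kummerCoeff α₁ β κ n / kummerCoeff α₂ β κ n =
      (ascPochhammer ℝ n).eval α₁ / (ascPochhammer ℝ n).eval α₂ := by
  have p2 := ascPochhammer_pos (S := ℝ) n β hβ
  have hf : (n.factorial : ℝ) ≠ 0 := by positivity
  unfold kummerCoeff
  rw [div_div_div_cancel_right₀ hf, mul_div_mul_right _ _ (by positivity),
    div_div_div_cancel_right₀ p2.ne']

theorem strictMono_ascPochhammer_div (hα₁ : 0 < α₁) (hlt : α₁ < α₂) :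
    StrictMono fun n => (ascPochhammer ℝ n).eval α₂ / (ascPochhammer ℝ n).eval α₁ := by
  refine strictMono_nat_of_lt_succ fun n => ?_
  have p1 := ascPochhammer_pos (S := ℝ) n α₁ hα₁
  have p2 := ascPochhammer_pos (S := ℝ) n α₂ (hα₁.trans hlt)
  have hn : (0 : ℝ) ≤ n := n.cast_nonneg
  rw [ascPochhammer_succ_eval, ascPochhammer_succ_eval, ← div_mul_div_comm]
  refine lt_mul_of_one_lt_right (div_pos p2 p1) ?_
  rw [one_lt_div (by positivity)]
  linarith

/-- The α-dependence (t/(1+t))^α equals exp(−α log(1 + 1/t)), with a logarithm that decreases in t.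
-/
theorem expFamily_kummer_eq {t : ℝ} (ht : 0 < t) :
    expFamily (fun t => (1 + t) ^ μ / t) (fun t => Real.log (1 + t⁻¹)) α t =
      t ^ (α - 1) * (1 + t) ^ (μ + 1 - α - 1) := by
  have h1 : 0 < 1 + t := by linarith
  have e : 1 + t⁻¹ = (1 + t) / t := by field_simp; ring
  have e2 : μ + 1 - α - 1 = μ - α := by ring
  have e3 : -(α * (Real.log (1 + t) - Real.log t)) = Real.log t * α - Real.log (1 + t) * α := by
    ring
  unfold expFamily
  beta_reduce
  rw [e, Real.log_div h1.ne' ht.ne', e2, Real.rpow_sub_one ht.ne', Real.rpow_sub h1, e3,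
    Real.exp_sub, ← Real.rpow_def_of_pos ht, ← Real.rpow_def_of_pos h1]
  ring

/-- Dominates the weight by two Gamma integrands, with exponents α − 1 and μ − 1 both above −1. It
rests on (1+t)^γ ≤ 2^|γ| (1 + t^γ) for either sign of γ. -/
theorem kummer_weight_le {t : ℝ} (ht : 0 < t) :
    t ^ (α - 1) * (1 + t) ^ (μ + 1 - α - 1) ≤ 2 ^ |μ - α| * (t ^ (α - 1) + t ^ (μ - 1)) := by
  have e2 : μ + 1 - α - 1 = μ - α := by ring
  rw [e2]
  have ha : 0 < t ^ (α - 1) := Real.rpow_pos_of_pos ht _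
  have hm : 0 < t ^ (μ - 1) := Real.rpow_pos_of_pos ht _
  have h2 : (1 : ℝ) ≤ 2 ^ |μ - α| := Real.one_le_rpow one_le_two (abs_nonneg _)
  have em : t ^ (μ - 1) = t ^ (α - 1) * t ^ (μ - α) := by
    rw [← Real.rpow_add ht]; ring_nf
  have key : (1 + t) ^ (μ - α) ≤ 2 ^ |μ - α| * (1 + t ^ (μ - α)) := by
    have hp : 0 < t ^ (μ - α) := Real.rpow_pos_of_pos ht _
    rcases le_total 0 (μ - α) with h | h
    · rw [abs_of_nonneg h, mul_add, mul_one, ← Real.mul_rpow zero_le_two ht.le]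
      have hp2 : (0 : ℝ) < 2 ^ (μ - α) := Real.rpow_pos_of_pos two_pos _
      rcases le_total t 1 with ht1 | ht1
      · have : (1 + t) ^ (μ - α) ≤ 2 ^ (μ - α) :=
          Real.rpow_le_rpow (by linarith) (by linarith) h
        have : 0 < (2 * t) ^ (μ - α) := Real.rpow_pos_of_pos (by linarith) _
        linarith
      · have : (1 + t) ^ (μ - α) ≤ (2 * t) ^ (μ - α) :=
          Real.rpow_le_rpow (by linarith) (by linarith) h
        linarith
    · have h1 : (1 + t) ^ (μ - α) ≤ 1 := Real.rpow_le_one_of_one_le_of_nonpos (by linarith) h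
      nlinarith
  calc t ^ (α - 1) * (1 + t) ^ (μ - α) ≤ t ^ (α - 1) * (2 ^ |μ - α| * (1 + t ^ (μ - α))) := by
        gcongr
    _ = _ := by rw [em]; ring

theorem isExpWeight_kummer (hα : 0 < α) (hμ : 0 < μ) :
    IsExpWeight (volume.restrict (Set.Ioi (0 : ℝ))) id (Set.Iio 0)
      (expFamily (fun t => (1 + t) ^ μ / t) (fun t => Real.log (1 + t⁻¹)) α) := by
  refine isExpWeight_expFamily (by fun_prop) (by fun_prop) (fun t ht => by positivity) ?_
  intro s (hs : s < 0)
  have hg1 := integrableOn_rpow_mul_exp_neg_mul_rpow (p := 1) (b := -s) (s := μ - 1) (by linarith)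
    one_pos (by linarith)
  have hg2 := integrableOn_rpow_mul_exp_neg_mul_rpow (p := 1) (b := -s) (s := α - 1) (by linarith)
    one_pos (by linarith)
  refine Integrable.mono' ((hg2.add hg1).const_mul (2 ^ |μ - α|)) ?_ ?_
  · refine Measurable.aestronglyMeasurable ?_
    unfold expFamily
    fun_prop
  · filter_upwards [ae_restrict_mem measurableSet_Ioi] with t (ht : 0 < t)
    rw [expFamily_kummer_eq ht, Real.norm_of_nonneg (by positivity)]
    simp only [Pi.add_apply, Real.rpow_one, neg_neg]
    have := mul_le_mul_of_nonneg_left (kummer_weight_le (α := α) (μ := μ) ht)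
      (Real.exp_pos (s * t)).le
    linarith

theorem kummerU_eq (κ x : ℝ) :
    kummerU α (μ + 1) (κ * x) = (Real.Gamma α)⁻¹ *
      expInt (volume.restrict (Set.Ioi (0 : ℝ))) id
        (expFamily (fun t => (1 + t) ^ μ / t) (fun t => Real.log (1 + t⁻¹)) α) (-(κ * x)) := by
  unfold kummerU expInt
  congr 1
  refine setIntegral_congr_fun measurableSet_Ioi fun t ht => ?_
  simp only [id]
  rw [expFamily_kummer_eq ht, mul_assoc]

end Kummer

theorem cir_hasRegularSolutions (lam0 lam1 nu0 : ℝ) (hlam1 : 0 < lam1) (hnu : 0 < nu0)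
    (hmu : 0 < 2 * lam0 / nu0 ^ 2 - 1) :
    (Diffusion.cir lam0 lam1 nu0 hlam1 hnu hmu).HasRegularSolutions (𝓝[>] 0) := by
  set X := Diffusion.cir lam0 lam1 nu0 hlam1 hnu hmu with hX
  set μ := 2 * lam0 / nu0 ^ 2 - 1 with hμ
  set κ := 2 * lam1 / nu0 ^ 2 with hκ
  have hκpos : 0 < κ := by positivity
  have hβ : 1 ≤ μ + 1 := by linarith
  have hβ' : 0 < μ + 1 := by linarith
  set p : ℝ → ℝ := fun ρ => ρ / lam1 with hp
  have hppos : ∀ ρ, 0 < ρ → 0 < p ρ := fun ρ hρ => div_pos hρ hlam1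
  have hpmono : ∀ ρ₁ ρ₂, ρ₁ < ρ₂ → p ρ₁ < p ρ₂ := fun ρ₁ ρ₂ hlt =>
    div_lt_div_of_pos_right hlt hlam1
  have hinv : ∀ t : ℝ, 0 < t → 0 < t⁻¹ := fun t ht => inv_pos.2 ht
  have hanti : StrictAntiOn (fun t : ℝ => Real.log (1 + t⁻¹)) (Set.Ioi 0) := fun x hx y hy hxy =>
    Real.log_lt_log (by linarith [hinv y hy]) (add_lt_add_right (inv_strictAnti₀ hx hxy) 1)
  have hB : ∀ t : ℝ, 0 < t → 0 < (1 + t) ^ μ / t := fun t ht => by positivity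
  have hP : IsExpRepr X.interval (X.phi .plus) (Measure.count : Measure ℕ) (fun n => (n : ℝ))
      Set.univ (fun ρ => kummerCoeff (p ρ) (μ + 1) κ) (fun _ => 1) Real.log (fun x => x⁻¹) :=
    { isOpen := X.isOpen_interval
      isOpen_param := isOpen_univ
      unbounded := isUnboundedNonneg_natCast
      weight := fun ρ hρ => isExpWeight_count (kummerCoeff_pos (hppos ρ hρ) hβ' hκpos)
        (summable_kummerCoeff (hppos ρ hρ) hβ hκpos)
      const_pos := fun _ _ => one_pos
      hasDerivAt := fun x (hx : 0 < x) => Real.hasDerivAt_log hx.ne'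
      mem := fun _ _ => trivial
      eq := fun ρ hρ x (hx : 0 < x) => by
        rw [expInt_count_log (kummerCoeff_pos (hppos ρ hρ) hβ' hκpos)
          (summable_kummerCoeff (hppos ρ hρ) hβ hκpos) hx, one_mul, ← kummerM_eq_tsum]
        rfl
      separated := fun ρ₁ ρ₂ hρ₁ hlt => by
        refine count_separated (kummerCoeff_pos (hppos ρ₁ hρ₁) hβ' hκpos) ?_
        simp only [kummerCoeff_div hβ' hκpos]
        exact strictMono_ascPochhammer_div (hppos ρ₁ hρ₁) (hpmono ρ₁ ρ₂ hlt) }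
  have hM : IsExpRepr X.interval (X.phi .minus) (volume.restrict (Set.Ioi (0 : ℝ))) id (Set.Iio 0)
      (fun ρ => expFamily (fun t => (1 + t) ^ μ / t) (fun t => Real.log (1 + t⁻¹)) (p ρ))
      (fun ρ => (Real.Gamma (p ρ))⁻¹) (fun x => -(κ * x)) (fun _ => -κ) :=
    { isOpen := X.isOpen_interval
      isOpen_param := isOpen_Iio
      unbounded := isUnboundedNonneg_id
      weight := fun ρ hρ => isExpWeight_kummer (hppos ρ hρ) hmu
      const_pos := fun ρ hρ => inv_pos.2 (Real.Gamma_pos_of_pos (hppos ρ hρ))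
      hasDerivAt := fun x _ => by simpa using ((hasDerivAt_id x).const_mul κ).fun_neg
      mem := fun x (hx : 0 < x) => neg_neg_of_pos (mul_pos hκpos hx)
      eq := fun ρ _ x _ => kummerU_eq κ x
      separated := fun ρ₁ ρ₂ _ hlt => expFamily_separated hB hanti (hpmono ρ₁ ρ₂ hlt) }
  refine Diffusion.hasRegularSolutions_of_halfLine (X := X) rfl hκpos hP hM ?_
    (fun ρ hρ => kummerCoeff_pos (hppos ρ hρ) hβ' hκpos) hppos hpmono hB hanti ?_ ?_
    (c := 1 / 2) (by norm_num) ?_ ?_ ?_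
  · intro ρ₁ ρ₂ hρ₁ hlt
    simp only [kummerCoeff_div hβ' hκpos]
    exact tendsto_ascPochhammer_div (hppos ρ₁ hρ₁) (hpmono ρ₁ ρ₂ hlt)
  · have h1 : Tendsto (fun t : ℝ => 1 + t⁻¹) atTop (𝓝 1) := by
      simpa using (tendsto_inv_atTop_zero (𝕜 := ℝ)).const_add 1
    have h2 := (Real.continuousAt_log one_ne_zero).tendsto.comp h1
    rwa [Real.log_one] at h2
  · intro t ht
    exact Real.log_pos (by linarith [hinv t ht])
  · intro t ht
    have ht0 := one_pos.trans_le ht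
    -- The constant 1/2 comes from log(1 + 1/t) ≥ 1/(t+1) ≥ 1/(2t) for t ≥ 1.
    have h1 := Real.one_sub_inv_le_log_of_pos (x := 1 + t⁻¹) (by positivity)
    refine le_trans ?_ h1
    have e : 1 - (1 + t⁻¹)⁻¹ = 1 / (t + 1) := by field_simp; ring
    rw [e, div_div]
    exact one_div_le_one_div_of_le (by linarith) (by linarith)
  · intro t ht
    have ht0 := one_pos.trans_le ht
    exact div_le_div_of_nonneg_right (Real.one_le_rpow (by linarith) hmu.le) ht0.le
  · intro (h1 : 1 ≤ μ) t ht
    have ht0 := one_pos.trans_le ht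
    rw [one_le_div ht0]
    have := Real.rpow_le_rpow_of_exponent_le (x := 1 + t) (by linarith) h1
    rw [Real.rpow_one] at this
    linarith

/-! ### The three diffusions together and the main theorem -/

theorem Diffusion.exists_hasRegularSolutions (X : Diffusion) : ∃ l, X.HasRegularSolutions l := by
  rcases X with ⟨_, _, h, hmu⟩ | ⟨_, _, _, hl, h, hmu⟩ | ⟨_, _, _, hl, h⟩
  exacts [⟨_, sqb_hasRegularSolutions _ _ h hmu⟩, ⟨_, cir_hasRegularSolutions _ _ _ hl h hmu⟩,
    ⟨_, ou_hasRegularSolutions _ _ _ hl h⟩]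

end AffineDiffusion

theorem lemma3 (X : AffineDiffusion.Diffusion) (a b ρ ε : ℝ)
    (hb : b ≠ 0) (hρ : 0 < ρ) (hρb : 0 < ρ + b) (hε : ε = 1 ∨ ε = -1) :
    -- first class: all parameters
    (∀ (s : AffineDiffusion.Pm) (c : ℝ), 0 < c →
      AffineDiffusion.StrictlyMonotonic X (AffineDiffusion.F1 X s a b ρ ε c) ∧
      AffineDiffusion.DerivHasSign X (AffineDiffusion.F1 X s a b ρ ε c) (s.val * ε)) ∧
    -- second class: all parameters
    (∀ (s : AffineDiffusion.Pm) (c : ℝ), 0 < c →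
      AffineDiffusion.StrictlyMonotonic X (AffineDiffusion.F2 X s a b ρ ε c) ∧
      AffineDiffusion.DerivHasSign X (AffineDiffusion.F2 X s a b ρ ε c)
        (s.val * ε * Real.sign b)) ∧
    -- third class: `b < 0`
    (b < 0 → ∀ (s : AffineDiffusion.Pm) (c₁ c₂ : ℝ), 0 < c₁ → 0 < c₂ →
      AffineDiffusion.StrictlyMonotonic X (AffineDiffusion.F3 X s a b ρ ε c₁ c₂) ∧
      AffineDiffusion.DerivHasSign X (AffineDiffusion.F3 X s a b ρ ε c₁ c₂) (s.val * ε)) ∧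
    -- fourth class: `b > 0`
    (0 < b → ∀ (s : AffineDiffusion.Pm) (q₁ q₂ : ℝ), 0 < q₁ → 0 < q₂ →
      AffineDiffusion.StrictlyMonotonic X (AffineDiffusion.F4 X s a b ρ ε q₁ q₂) ∧
      AffineDiffusion.DerivHasSign X (AffineDiffusion.F4 X s a b ρ ε q₁ q₂) (s.val * ε)) ∧
    -- fifth class: if and only if `b > 0`; at most one of `q₁`, `q₂` is zero
    (∀ q₁ q₂ : ℝ, 0 ≤ q₁ → 0 ≤ q₂ → (0 < q₁ ∨ 0 < q₂) →
      -- sign of the derivative for `b > 0`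
      (0 < b → ∀ c₁ c₂ : ℝ, 0 < c₁ → 0 < c₂ →
        AffineDiffusion.DerivHasSign X (AffineDiffusion.F5 X a b ρ ε c₁ c₂ q₁ q₂) ε) ∧
      -- the equivalence for the family of maps indexed by `c₁`, `c₂`
      ((∀ c₁ c₂ : ℝ, 0 < c₁ → 0 < c₂ →
        AffineDiffusion.StrictlyMonotonic X (AffineDiffusion.F5 X a b ρ ε c₁ c₂ q₁ q₂)) ↔
          0 < b) ∧
      -- the equivalence for each individual map
      (0 < q₁ ∨ X.IsOUOrOneLeMu → ∀ c₁ c₂ : ℝ, 0 < c₁ → 0 < c₂ →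
        (AffineDiffusion.StrictlyMonotonic X (AffineDiffusion.F5 X a b ρ ε c₁ c₂ q₁ q₂) ↔
          0 < b))) := by
  obtain ⟨l, h⟩ := X.exists_hasRegularSolutions
  have hsign : ∀ s : AffineDiffusion.Pm, s.val * ε = 1 ∨ s.val * ε = -1 := by
    rintro (_ | _) <;> rcases hε with rfl | rfl <;> norm_num [AffineDiffusion.Pm.val]
  have hsign' : ∀ s : AffineDiffusion.Pm,
      s.val * ε * Real.sign b = 1 ∨ s.val * ε * Real.sign b = -1 := by
    intro s
    rcases lt_or_gt_of_ne hb with hb | hb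
    · rw [Real.sign_of_neg hb]
      rcases hsign s with h | h <;> norm_num [h]
    · rw [Real.sign_of_pos hb, mul_one]
      exact hsign s
  refine ⟨fun s c hc => ?_, fun s c hc => ?_, fun hb s c₁ c₂ hc₁ hc₂ => ?_,
    fun hb s q₁ q₂ hq₁ hq₂ => ?_, fun q₁ q₂ hq₁ hq₂ hq => ⟨fun hb c₁ c₂ hc₁ hc₂ => ?_, ?_,
      fun hX c₁ c₂ hc₁ hc₂ => ?_⟩⟩
  · have hd := h.derivHasSign_F1 (a := a) hρ hρb hε s hc
    exact ⟨hd.strictlyMonotonic (hsign s), hd⟩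
  · have hd := h.derivHasSign_F2 (a := a) hb hρ hρb hε s hc
    exact ⟨hd.strictlyMonotonic (hsign' s), hd⟩
  · have hd := h.derivHasSign_F3 (a := a) hb hρ hρb hε s hc₁ hc₂
    exact ⟨hd.strictlyMonotonic (hsign s), hd⟩
  · have hd := h.derivHasSign_F4 (a := a) hb hρ hρb hε s hq₁ hq₂
    exact ⟨hd.strictlyMonotonic (hsign s), hd⟩
  · exact h.derivHasSign_F5 hb hρ hρb hε hc₁ hc₂ hq₁ hq₂ hq
  · exact h.forall_strictlyMonotonic_F5_iff hb hρ hρb hε hq₁ hq₂ hq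
  · exact h.strictlyMonotonic_F5_iff hb hρ hρb hε hc₁ hc₂ hq₁ hq₂ hq hX
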